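/- Theorem. For an irrational real number $x$ let $$k(x)=\sup\Big\{c>0 \;\Big|\; \Big|x-\frac pq\Big|<\frac1{cq^2}\text{ has infinitely many rational solutions }\frac pq\Big\}\in(0,\infty]$$ be its Lagrange value, where a rational solution is a rational number $p/q$ written in lowest terms with $q\ge 1$. For a bi-infinite sequence $\omega=(\omega_i)_{i\in\mathbb Z}$ of positive integers let $$m(\omega)=\sup_{n\in\mathbb Z}\big([\omega_n;\omega_{n+1},\omega_{n+2},\dots]+[0;\omega_{n-1},\omega_{n-2},\dots]\big)\in(0,\infty]$$ be its Markov value, where $[a_0;a_1,a_2,\dots]$ denotes the value of the continued fraction, and let $\pi(\omega)=(\omega_i)_{i\ge 0}$. For $n\in\mathbb N\cup\{\infty\}$, with $\mathbb N=\{0,1,2,\dots\}$, let $$X_3(n)=\Big\{x\in\mathbb R\setminus\mathbb Q \;\Big|\; k(x)=3 \text{ and } \Big|x-\frac pq\Big|<\frac1{3q^2}\text{ has exactly } n \text{ rational solutions }\frac pq\Big\},$$ $$Y_3(n)=\big\{x\in X_3(n) \;\big|\; x=[0;\pi(\omega)]=[0;\omega_0,\omega_1,\omega_2,\dots]\text{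 for some bi-infinite sequence }\omega\text{ with } m(\omega)=3\big\}.$$ Then for every $n\in\mathbb N\cup\{\infty\}$ the set $Y_3(n)$ is uncountable. -/

import Mathlib

namespace LagrangeThree

open Filter Topology

noncomputable section

/-- The formal infinite continued fraction `[a₀; a 0, a 1, a 2, …]`. -/
def contFrac (a₀ : ℤ) (a : ℕ → ℕ+) : GenContFract ℝ :=
  ⟨(a₀ : ℝ), Stream'.Seq.ofStream (fun i => ⟨1, ((a i : ℕ) : ℝ)⟩)⟩

/-- The real number `[a₀; a 0, a 1, a 2, …]`, the limit of the convergents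
(the limit exists, see `tendsto_convs`). -/
def cfValue (a₀ : ℤ) (a : ℕ → ℕ+) : ℝ :=
  limUnder atTop (contFrac a₀ a).convs

theorem contFrac_get (a₀ : ℤ) (a : ℕ → ℕ+) (n : ℕ) :
    (contFrac a₀ a).s.get? n = some ⟨1, ((a n : ℕ) : ℝ)⟩ := rfl

theorem dens_zero (a₀ : ℤ) (a : ℕ → ℕ+) : (contFrac a₀ a).dens 0 = 1 :=
  GenContFract.zeroth_den_eq_one

theorem dens_one (a₀ : ℤ) (a : ℕ → ℕ+) : (contFrac a₀ a).dens 1 = (a 0 : ℕ) :=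
  GenContFract.first_den_eq (contFrac_get a₀ a 0)

theorem nums_zero (a₀ : ℤ) (a : ℕ → ℕ+) : (contFrac a₀ a).nums 0 = a₀ :=
  GenContFract.zeroth_num_eq_h

theorem nums_one (a₀ : ℤ) (a : ℕ → ℕ+) :
    (contFrac a₀ a).nums 1 = (a 0 : ℕ) * a₀ + 1 :=
  GenContFract.first_num_eq (contFrac_get a₀ a 0)

theorem dens_rec (a₀ : ℤ) (a : ℕ → ℕ+) (n : ℕ) :
    (contFrac a₀ a).dens (n + 2) =
      (a (n + 1) : ℕ) * (contFrac a₀ a).dens (n + 1) + (contFrac a₀ a).dens n := by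
  rw [GenContFract.dens_recurrence (contFrac_get a₀ a (n + 1)) rfl rfl, one_mul]

theorem nums_rec (a₀ : ℤ) (a : ℕ → ℕ+) (n : ℕ) :
    (contFrac a₀ a).nums (n + 2) =
      (a (n + 1) : ℕ) * (contFrac a₀ a).nums (n + 1) + (contFrac a₀ a).nums n := by
  rw [GenContFract.nums_recurrence (contFrac_get a₀ a (n + 1)) rfl rfl, one_mul]

theorem one_le_letter (a : ℕ → ℕ+) (n : ℕ) : (1 : ℝ) ≤ ((a n : ℕ) : ℝ) := by
  exact_mod_cast (a n).pos

theorem dens_mono (a₀ : ℤ) (a : ℕ → ℕ+) (n : ℕ) :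
    1 ≤ (contFrac a₀ a).dens n ∧ (contFrac a₀ a).dens n ≤ (contFrac a₀ a).dens (n + 1) := by
  induction n with
  | zero =>
    rw [dens_zero, zero_add, dens_one]
    exact ⟨le_refl _, one_le_letter a 0⟩
  | succ n ih =>
    refine ⟨ih.1.trans ih.2, ?_⟩
    rw [dens_rec]
    nlinarith [one_le_letter a (n + 1), ih.1, ih.2]

theorem two_pow_le (a₀ : ℤ) (a : ℕ → ℕ+) (n : ℕ) :
    (2 : ℝ) ^ n ≤ (contFrac a₀ a).dens n * (contFrac a₀ a).dens (n + 1) := by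
  induction n with
  | zero =>
    have h := dens_mono a₀ a 0
    rw [pow_zero]
    nlinarith [h.1, h.2]
  | succ n ih =>
    have h := dens_mono a₀ a n
    have h2 : 2 * (contFrac a₀ a).dens n ≤ (contFrac a₀ a).dens (n + 2) := by
      rw [dens_rec]
      nlinarith [one_le_letter a (n + 1), h.1, h.2]
    rw [pow_succ]
    nlinarith [h.1, h.2]

theorem nums_dens_det (a₀ : ℤ) (a : ℕ → ℕ+) (n : ℕ) :
    (contFrac a₀ a).nums n * (contFrac a₀ a).dens (n + 1)
      - (contFrac a₀ a).dens n * (contFrac a₀ a).nums (n + 1) = (-1) ^ (n + 1) := by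
  induction n with
  | zero =>
    rw [zero_add, nums_zero, nums_one, dens_zero, dens_one]
    ring
  | succ n ih =>
    rw [nums_rec, dens_rec, pow_succ, ← ih]
    ring

theorem tendsto_convs (a₀ : ℤ) (a : ℕ → ℕ+) :
    Tendsto (contFrac a₀ a).convs atTop (𝓝 (cfValue a₀ a)) := by
  refine CauchySeq.tendsto_limUnder ?_
  refine cauchySeq_of_le_geometric (1 / 2) 1 (by norm_num) (fun n => ?_)
  have h := dens_mono a₀ a n
  have h0 : 0 < (contFrac a₀ a).dens n := by linarith [h.1]
  have h1 : 0 < (contFrac a₀ a).dens (n + 1) := by linarith [h.1, h.2]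
  change dist ((contFrac a₀ a).nums n / (contFrac a₀ a).dens n)
    ((contFrac a₀ a).nums (n + 1) / (contFrac a₀ a).dens (n + 1)) ≤ _
  rw [Real.dist_eq, div_sub_div _ _ h0.ne' h1.ne', nums_dens_det, abs_div, abs_pow, abs_neg,
    abs_one, one_pow, abs_of_pos (mul_pos h0 h1), one_mul, one_div_pow]
  exact one_div_le_one_div_of_le (by positivity) (two_pow_le a₀ a n)

/-- Rational solutions `p/q` (in lowest terms) of `|x - p/q| < 1/(c q²)`. -/
def solutions (c x : ℝ) : Set ℚ :=
  {r : ℚ | |x - (r : ℝ)| < 1 / (c * (r.den : ℝ) ^ 2)}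

/-- The Lagrange value `k(x)`, as an extended real number. -/
def lagrangeValue (x : ℝ) : EReal :=
  ⨆ c ∈ {c : ℝ | 0 < c ∧ (solutions c x).Infinite}, (c : EReal)

/-- Bi-infinite words over the alphabet of positive integers. -/
abbrev BiWord : Type := ℤ → ℕ+

/-- The word `w` re-centred at position `n`. -/
def shift (n : ℤ) (w : BiWord) : BiWord := fun i => w (n + i)

/-- The height `[w₀; w₁, w₂, …] + [0; w₋₁, w₋₂, …]`. -/
def height (w : BiWord) : ℝ :=
  cfValue (((w 0 : ℕ+) : ℕ) : ℤ) (fun i : ℕ => w ((i : ℤ) + 1)) +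
    cfValue 0 (fun i : ℕ => w (-((i : ℤ) + 1)))

/-- The Markov value `m(w)`, as an extended real number. -/
def markovValue (w : BiWord) : EReal :=
  ⨆ n : ℤ, ((height (shift n w) : ℝ) : EReal)

/-- The projection to the right part `w₀ w₁ w₂ …`. -/
def proj (w : BiWord) : ℕ → ℕ+ := fun i => w (i : ℤ)

/-- Irrational numbers with Lagrange value `3` for which `|x - p/q| < 1/(3q²)` has exactly `n`
rational solutions. -/
def X3 (n : ℕ∞) : Set ℝ :=
  {x : ℝ | Irrational x ∧ lagrangeValue x = 3 ∧ (solutions 3 x).encard = n}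

/-- The elements of `X3 n` of the form `[0; w₀, w₁, w₂, …]` with `w` a bi-infinite word of
Markov value `3`. -/
def Y3 (n : ℕ∞) : Set ℝ :=
  {x : ℝ | x ∈ X3 n ∧ ∃ w : BiWord, markovValue w = 3 ∧ x = cfValue 0 (proj w)}

end

end LagrangeThree

/-! Code the letters by pairs of digits: `true` is a = 22 and `false` is b = 11. In a factor ab or
ba, the height at the digit of a next to b is 3 + 1/(2+v) - 1/(2+u), where v is the value of the
word beyond a and u the value of the word beyond b, both read outwards. All other heights are at
most 3. Values compare lexicographically with a < b, so a height above 3 forces a factor a P̃ ab P b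
or b P̃ ba P a, with P̃ the reversal of P. A bi-infinite word without such factors has all heights
at most 3, and long factors P̃ ab P give heights close to 3; hence its Markov value is 3
(`markovValue_eq_three`).

For the number x the past is finite: its value ends in 0 instead of a positive tail. If the past
runs out before the comparison is decided, it counts as the smaller side. This pushes an ab above 3
and keeps a ba below 3. By Legendre's theorem every solution is a convergent, so the solutions for c
= 3 correspond to the prefixes P̃ ab P of the word (`encard_three_lt_quality`).

It remains to produce words with a prescribed number of such prefixes. The substitutions G, G', E
create no forbidden factor (`HasAscent.of_subG`, `HasDescent.of_subG` and symmetry). E preserves the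
number of mirrored prefixes; G adds one, the prefix ab, exactly when the word starts with b; G'
preserves the number on words starting with b. So GE and GGE add exactly one, whereas under G'E and
G'G'E each mirrored prefix comes from one with strictly shorter P; a word directed only by the
latter has none, by infinite descent. Taking n blocks of the first kind and then only the second
kind, or only the first kind for n = ∞, gives exactly n. The choice between one and two copies of G
or G' in each block is a free binary sequence that can be read off from the word (`ray_injective`),
whence uncountably many numbers. -/

namespace LagrangeThree

open Filter Topology

/-! ### Three substitutions on the letters `true` and `false` -/

/-- The substitution `a ↦ a`, `b ↦ ab`, where `a = true` and `b = false`. -/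
def subG (w : List Bool) : List Bool :=
  w.flatMap fun c => bif c then [true] else [true, false]

/-- The substitution `a ↦ a`, `b ↦ ba`. -/
def subG' (w : List Bool) : List Bool :=
  w.flatMap fun c => bif c then [true] else [false, true]

/-- The substitution `a ↦ ba`, `b ↦ b`. -/
def subE (w : List Bool) : List Bool :=
  w.flatMap fun c => bif c then [false, true] else [false]

@[simp] theorem subG_nil : subG [] = [] := rfl
@[simp] theorem subG_true (w : List Bool) : subG (true :: w) = true :: subG w := rfl
@[simp] theorem subG_false (w : List Bool) : subG (false :: w) = true :: false :: subG w := rfl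
@[simp] theorem subG'_nil : subG' [] = [] := rfl
@[simp] theorem subG'_true (w : List Bool) : subG' (true :: w) = true :: subG' w := rfl
@[simp] theorem subG'_false (w : List Bool) : subG' (false :: w) = false :: true :: subG' w := rfl
@[simp] theorem subE_nil : subE [] = [] := rfl
@[simp] theorem subE_true (w : List Bool) : subE (true :: w) = false :: true :: subE w := rfl
@[simp] theorem subE_false (w : List Bool) : subE (false :: w) = false :: subE w := rfl

@[simp] theorem subG_append (v w : List Bool) : subG (v ++ w) = subG v ++ subG w :=
  List.flatMap_append

@[simp] theorem subG'_append (v w : List Bool) : subG' (v ++ w) = subG' v ++ subG' w :=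
  List.flatMap_append

@[simp] theorem subE_append (v w : List Bool) : subE (v ++ w) = subE v ++ subE w :=
  List.flatMap_append

/-- G and G' are conjugate by the letter a. As reversal exchanges them, this moves a letter across a
reversed image, the device behind all computations with P̃. -/
theorem cons_subG' (w : List Bool) : true :: subG' w = subG w ++ [true] := by
  induction w with
  | nil => rfl
  | cons c w ih => cases c <;> simp [ih]

theorem reverse_subG (w : List Bool) : (subG w).reverse = subG' w.reverse := by
  induction w with
  | nil => rfl
  | cons c w ih => cases c <;> simp [ih]

theorem reverse_subG' (w : List Bool) : (subG' w).reverse = subG w.reverse := by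
  induction w with
  | nil => rfl
  | cons c w ih => cases c <;> simp [ih]

theorem cons_reverse_subG (w : List Bool) :
    true :: (subG w).reverse = subG w.reverse ++ [true] := by
  rw [reverse_subG, cons_subG']

@[simp] theorem not_comp_not : not ∘ not = id := funext Bool.not_not

/-- Exchanging the two letters turns G into E, so facts about E follow from those about G. -/
theorem subE_eq_map (w : List Bool) : subE w = (subG (w.map not)).map not := by
  induction w with
  | nil => rfl
  | cons c w ih => cases c <;> simp [ih]

theorem cons_reverse_subE (w : List Bool) :
    false :: (subE w).reverse = subE w.reverse ++ [false] := by
  have h := congrArg (List.map not) (cons_reverse_subG (w.map not))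
  simpa [subE_eq_map] using h

theorem length_le_subG (w : List Bool) : w.length ≤ (subG w).length := by
  induction w with
  | nil => simp
  | cons c w ih => cases c <;> simp <;> omega

theorem length_le_subG' (w : List Bool) : w.length ≤ (subG' w).length := by
  induction w with
  | nil => simp
  | cons c w ih => cases c <;> simp <;> omega

theorem length_le_subE (w : List Bool) : w.length ≤ (subE w).length := by
  induction w with
  | nil => simp
  | cons c w ih => cases c <;> simp <;> omega

/-- An image under G can be cut anywhere except inside a block ab, that is, except just before a b.
-/
theorem subG_split {w x y : List Bool} (h : subG w = x ++ y) (hy : ∀ z, y ≠ false :: z) :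
    ∃ v u, w = v ++ u ∧ subG v = x ∧ subG u = y := by
  induction w generalizing x with
  | nil =>
    obtain ⟨rfl, rfl⟩ : x = [] ∧ y = [] := by simpa using h
    exact ⟨[], [], rfl, rfl, rfl⟩
  | cons c w ih =>
    rcases x with _ | ⟨d, x⟩
    · exact ⟨[], c :: w, rfl, rfl, h⟩
    cases c
    · rcases x with _ | ⟨d', x⟩
      · simp at h
        exact absurd h.2.symm (hy _)
      · simp at h
        obtain ⟨rfl, rfl, h⟩ := h
        obtain ⟨v, u, rfl, rfl, rfl⟩ := ih h
        exact ⟨false :: v, u, rfl, rfl, rfl⟩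
    · simp at h
      obtain ⟨rfl, h⟩ := h
      obtain ⟨v, u, rfl, rfl, rfl⟩ := ih h
      exact ⟨true :: v, u, rfl, rfl, rfl⟩

theorem subG_before_false {w x y : List Bool} (h : subG w = x ++ false :: y) :
    ∃ z, x = z ++ [true] := by
  induction w generalizing x with
  | nil => simp at h
  | cons c w ih =>
    rcases x with _ | ⟨d, x⟩
    · cases c <;> simp at h
    cases c
    · rcases x with _ | ⟨d', x⟩
      · simp at h
        exact ⟨[], by simp [h.1]⟩
      · simp at h
        obtain ⟨z, rfl⟩ := ih h.2.2
        exact ⟨d :: d' :: z, rfl⟩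
    · simp at h
      obtain ⟨z, rfl⟩ := ih h.2
      exact ⟨d :: z, rfl⟩

theorem subG_letter_before_false {w x y : List Bool} {c : Bool}
    (h : subG w = x ++ c :: false :: y) : c = true := by
  obtain ⟨z, hz⟩ := subG_before_false (x := x ++ [c]) (y := y) (by rw [h]; simp)
  simpa using (List.append_inj' hz rfl).2

theorem subG_injective : Function.Injective subG := by
  intro v w h
  induction v generalizing w with
  | nil =>
    rcases w with _ | ⟨c, w⟩
    · rfl
    · cases c <;> simp at h
  | cons c v ih =>
    rcases w with _ | ⟨d, w⟩
    · cases c <;> simp at h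
    cases c <;> cases d <;> simp at h
    · rw [ih h]
    · obtain ⟨z, hz⟩ := subG_before_false (x := []) h.symm
      simp at hz
    · obtain ⟨z, hz⟩ := subG_before_false (x := []) h
      simp at hz
    · rw [ih h]

theorem map_not_map_not (w : List Bool) : (w.map not).map not = w := by
  simp

theorem subE_split {w x y : List Bool} (h : subE w = x ++ y) (hy : ∀ z, y ≠ true :: z) :
    ∃ v u, w = v ++ u ∧ subE v = x ∧ subE u = y := by
  have h' : subG (w.map not) = x.map not ++ y.map not := by
    have := congrArg (List.map not) h
    simpa [subE_eq_map] using this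
  obtain ⟨v, u, hw, hv, hu⟩ := subG_split h' (by
    intro z hz
    apply hy (z.map not)
    have := congrArg (List.map not) hz
    simpa using this)
  refine ⟨v.map not, u.map not, ?_, ?_, ?_⟩
  · have := congrArg (List.map not) hw
    simpa using this
  · simp [subE_eq_map, hv]
  · simp [subE_eq_map, hu]

theorem subE_before_true {w x y : List Bool} (h : subE w = x ++ true :: y) :
    ∃ z, x = z ++ [false] := by
  have h' : subG (w.map not) = x.map not ++ false :: y.map not := by
    have := congrArg (List.map not) h
    simpa [subE_eq_map] using this
  obtain ⟨z, hz⟩ := subG_before_false h'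
  refine ⟨z.map not, ?_⟩
  have := congrArg (List.map not) hz
  simpa using this

theorem subE_injective : Function.Injective subE := by
  intro v w h
  rw [subE_eq_map, subE_eq_map] at h
  have h := congrArg (List.map not) h
  rw [map_not_map_not, map_not_map_not] at h
  have h := congrArg (List.map not) (subG_injective h)
  rwa [map_not_map_not, map_not_map_not] at h

/-! ### Forbidden factors -/

/-- `w` has a factor `a P̃ ab P b`, with `P̃` the reversal of `P`. -/
def HasAscent (w : List Bool) : Prop :=
  ∃ P : List Bool, true :: P.reverse ++ [true, false] ++ P ++ [false] <:+: w

/-- `w` has a factor `b P̃ ba P a`, with `P̃` the reversal of `P`. -/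
def HasDescent (w : List Bool) : Prop :=
  ∃ P : List Bool, false :: P.reverse ++ [false, true] ++ P ++ [true] <:+: w

theorem HasAscent.reverse {w : List Bool} (h : HasAscent w) : HasDescent w.reverse := by
  obtain ⟨P, hP⟩ := h
  refine ⟨P, ?_⟩
  have := List.reverse_infix.2 hP
  simpa using this

theorem HasDescent.reverse {w : List Bool} (h : HasDescent w) : HasAscent w.reverse := by
  obtain ⟨P, hP⟩ := h
  refine ⟨P, ?_⟩
  have := List.reverse_infix.2 hP
  simpa using this

theorem HasAscent.map_not {w : List Bool} (h : HasAscent w) : HasDescent (w.map not) := by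
  obtain ⟨P, hP⟩ := h
  refine ⟨P.map not, ?_⟩
  have := hP.map not
  simpa using this

theorem HasDescent.map_not {w : List Bool} (h : HasDescent w) : HasAscent (w.map not) := by
  obtain ⟨P, hP⟩ := h
  refine ⟨P.map not, ?_⟩
  have := hP.map not
  simpa using this

/-- In a G-image every b follows an a, so P = P'a, and cutting gives P' = G(Q). Then aaP̃' ab P'ab =
G(a Q̃ ab Q b), because a followed by the reversal of G(Q) is G(Q̃)a. -/
theorem HasAscent.of_subG {w : List Bool} (h : HasAscent (subG w)) : HasAscent w := by
  obtain ⟨P, x, y, h⟩ := h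
  have hP : ∃ P', P = P' ++ [true] := by
    rcases List.eq_nil_or_concat' P with rfl | ⟨P', c, rfl⟩
    · have := subG_letter_before_false (w := w) (x := x ++ [true, true]) (c := false) (y := y)
        (by rw [← h]; simp)
      simp at this
    · have := subG_letter_before_false (w := w) (y := y) (c := c)
        (x := x ++ (true :: (P' ++ [c]).reverse ++ [true, false] ++ P')) (by rw [← h]; simp)
      exact ⟨P', by rw [this]⟩
  obtain ⟨P', rfl⟩ := hP
  have hy : ∀ z, y ≠ false :: z := by
    rintro z rfl
    have := subG_letter_before_false (w := w) (y := z) (c := false)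
      (x := x ++ (true :: (P' ++ [true]).reverse ++ [true, false] ++ (P' ++ [true])))
      (by rw [← h]; simp)
    simp at this
  have hP1 : ∀ z, P' ++ [true, false] ++ y ≠ false :: z := by
    intro z hz
    have := subG_letter_before_false (w := w) (y := z) (c := false)
      (x := x ++ (true :: (P' ++ [true]).reverse ++ [true])) (by
        rw [← h]
        simp only [List.append_assoc, List.cons_append, List.nil_append] at hz ⊢
        rw [← hz])
    simp at this
  obtain ⟨v, u, rfl, hv, hu⟩ := subG_split (w := w)
    (x := x ++ (true :: (P' ++ [true]).reverse ++ [true, false]))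
    (y := P' ++ [true, false] ++ y) (by rw [← h]; simp) hP1
  obtain ⟨Q, u', rfl, rfl, -⟩ := subG_split (w := u) (x := P') (y := [true, false] ++ y)
    (by rw [hu]; simp) (by simp)
  have key : subG (v ++ (Q ++ u')) =
      x ++ (subG (true :: Q.reverse ++ [true, false] ++ Q ++ [false]) ++ y) := by
    rw [← h]
    have := cons_reverse_subG Q
    simp only [List.reverse_append, List.reverse_cons, List.reverse_nil, List.nil_append,
      List.cons_append, subG_append, subG_true, subG_false, subG_nil, List.append_assoc, this]
  obtain ⟨v1, u1, h1, -, hu1⟩ := subG_split key (by simp)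
  obtain ⟨m, u2, rfl, hm, -⟩ := subG_split hu1 hy
  rw [h1]
  refine ⟨Q, v1, u2, ?_⟩
  rw [← subG_injective hm]
  simp

/-- Here P = aP', the initial b of the factor follows an a, and the reversal of P' is some G(Q).
Including that preceding a, the factor becomes G(b Q ba Q̃ a)a, where aP' = aG'(Q̃) = G(Q̃)a. -/
theorem HasDescent.of_subG {w : List Bool} (h : HasDescent (subG w)) : HasDescent w := by
  obtain ⟨P, x, y, h⟩ := h
  have hP : ∃ P', P = true :: P' := by
    rcases P with _ | ⟨c, P'⟩
    · have := subG_letter_before_false (w := w) (x := x) (c := false) (y := [true, true] ++ y)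
        (by rw [← h]; simp)
      simp at this
    · have := subG_letter_before_false (w := w) (x := x ++ (false :: P'.reverse)) (c := c)
        (y := [true] ++ (c :: P') ++ [true] ++ y) (by rw [← h]; simp)
      exact ⟨P', by rw [this]⟩
  obtain ⟨P', rfl⟩ := hP
  have hb : ∀ z, P'.reverse ++ [true, false] ++ [true, true] ++ P' ++ [true] ++ y
      ≠ false :: z := by
    intro z hz
    have := subG_letter_before_false (w := w) (y := z) (c := false) (x := x) (by
      rw [← h]
      simp at hz
      simp [hz])
    simp at this
  obtain ⟨v, u, rfl, hv, hu⟩ := subG_split (w := w) (x := x ++ [false])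
    (y := P'.reverse ++ [true, false] ++ [true, true] ++ P' ++ [true] ++ y)
    (by rw [← h]; simp) hb
  obtain ⟨Q, u', rfl, hQ, -⟩ := subG_split (w := u) (x := P'.reverse)
    (y := [true, false] ++ [true, true] ++ P' ++ [true] ++ y)
    (by rw [hu]; simp) (by simp)
  have hPQ : P' = subG' Q.reverse := by
    rw [← reverse_subG, hQ, List.reverse_reverse]
  obtain ⟨x', rfl⟩ := subG_before_false (w := v) (x := x) (y := []) hv
  have key : subG (v ++ (Q ++ u')) =
      x' ++ (subG (false :: Q ++ [false, true] ++ Q.reverse ++ [true]) ++ (true :: y)) := by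
    rw [← h, hPQ]
    have h1 := cons_subG' Q.reverse
    simp only [List.reverse_cons, List.nil_append, List.cons_append, subG_append, subG_true,
      subG_false, subG_nil, List.append_assoc, reverse_subG', List.reverse_reverse]
    congr 6
    rw [← List.cons_append, h1]
    simp
  obtain ⟨v1, u1, h1, -, hu1⟩ := subG_split key (by simp)
  obtain ⟨m, u2, rfl, hm, -⟩ := subG_split hu1 (by simp)
  rw [h1, subG_injective hm]
  exact ⟨Q.reverse, v1, u2, by simp⟩

/-- `w` has none of the forbidden factors. -/
def Admissible (w : List Bool) : Prop := ¬ HasAscent w ∧ ¬ HasDescent w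

theorem Admissible.subG {w : List Bool} (h : Admissible w) : Admissible (subG w) :=
  ⟨fun h' => h.1 h'.of_subG, fun h' => h.2 h'.of_subG⟩

theorem Admissible.reverse {w : List Bool} (h : Admissible w) : Admissible w.reverse :=
  ⟨fun h' => h.2 (by simpa using h'.reverse), fun h' => h.1 (by simpa using h'.reverse)⟩

theorem Admissible.map_not {w : List Bool} (h : Admissible w) : Admissible (w.map not) :=
  ⟨fun h' => h.2 (by simpa using h'.map_not), fun h' => h.1 (by simpa using h'.map_not)⟩

theorem Admissible.subG' {w : List Bool} (h : Admissible w) : Admissible (subG' w) := by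
  have := h.reverse.subG.reverse
  rwa [reverse_subG, List.reverse_reverse] at this

theorem Admissible.subE {w : List Bool} (h : Admissible w) : Admissible (subE w) := by
  rw [subE_eq_map]
  exact h.map_not.subG.map_not

theorem Admissible.of_infix {v w : List Bool} (h : Admissible w) (hv : v <:+: w) :
    Admissible v :=
  ⟨fun ⟨P, hP⟩ => h.1 ⟨P, hP.trans hv⟩, fun ⟨P, hP⟩ => h.2 ⟨P, hP.trans hv⟩⟩

/-- A forbidden factor has at least four letters. -/
theorem admissible_pair (c d : Bool) : Admissible [c, d] := by
  constructor <;> rintro ⟨P, hP⟩ <;> have := hP.length_le <;> simp at this <;> omega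

/-! ### Prefix languages of infinite words -/

/-- The set of prefixes of an infinite word. -/
structure IsRay (L : Set (List Bool)) : Prop where
  nil_mem : [] ∈ L
  exists_concat : ∀ w ∈ L, ∃ c, w ++ [c] ∈ L
  prefix_mem : ∀ {v w : List Bool}, v <+: w → w ∈ L → v ∈ L
  prefix_total : ∀ {v w : List Bool}, v ∈ L → w ∈ L → v <+: w ∨ w <+: v

/-- A multiplicative length-nondecreasing map on words. -/
structure IsSubst (φ : List Bool → List Bool) : Prop where
  append : ∀ v w, φ (v ++ w) = φ v ++ φ w
  length_le : ∀ w, w.length ≤ (φ w).length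

theorem isSubst_subG : IsSubst subG := ⟨subG_append, length_le_subG⟩

theorem isSubst_subG' : IsSubst subG' := ⟨subG'_append, length_le_subG'⟩

theorem isSubst_subE : IsSubst subE := ⟨subE_append, length_le_subE⟩

theorem IsSubst.comp {φ ψ : List Bool → List Bool} (hφ : IsSubst φ) (hψ : IsSubst ψ) :
    IsSubst (φ ∘ ψ) :=
  ⟨fun v w => by simp [hφ.append, hψ.append],
    fun w => (hψ.length_le w).trans (hφ.length_le _)⟩

theorem IsSubst.prefix_map {φ : List Bool → List Bool} (hφ : IsSubst φ) {v w : List Bool}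
    (h : v <+: w) : φ v <+: φ w := by
  obtain ⟨u, rfl⟩ := h
  rw [hφ.append]
  exact List.prefix_append _ _

theorem IsSubst.suffix_map {φ : List Bool → List Bool} (hφ : IsSubst φ) {v w : List Bool}
    (h : v <:+ w) : φ v <:+ φ w := by
  obtain ⟨u, rfl⟩ := h
  rw [hφ.append]
  exact List.suffix_append _ _

/-- The prefixes of the image of an infinite word under a substitution. -/
def imageLang (φ : List Bool → List Bool) (L : Set (List Bool)) : Set (List Bool) :=
  {w | ∃ v ∈ L, w <+: φ v}

theorem mem_imageLang {φ : List Bool → List Bool} {L : Set (List Bool)} {v : List Bool}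
    (h : v ∈ L) : φ v ∈ imageLang φ L :=
  ⟨v, h, List.prefix_rfl⟩

theorem imageLang_comp {φ ψ : List Bool → List Bool} (hφ : IsSubst φ) (L : Set (List Bool)) :
    imageLang (φ ∘ ψ) L = imageLang φ (imageLang ψ L) := by
  ext w
  constructor
  · rintro ⟨v, hv, hw⟩
    exact ⟨ψ v, mem_imageLang hv, hw⟩
  · rintro ⟨u, ⟨v, hv, hu⟩, hw⟩
    exact ⟨v, hv, hw.trans (hφ.prefix_map hu)⟩

theorem IsRay.exists_longer {L : Set (List Bool)} (hL : IsRay L) {w : List Bool} (hw : w ∈ L)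
    (n : ℕ) : ∃ v ∈ L, w <+: v ∧ n ≤ v.length := by
  induction n with
  | zero => exact ⟨w, hw, List.prefix_rfl, Nat.zero_le _⟩
  | succ n ih =>
    obtain ⟨v, hv, hwv, hn⟩ := ih
    obtain ⟨c, hc⟩ := hL.exists_concat v hv
    exact ⟨_, hc, hwv.trans (List.prefix_append _ _), by simpa using hn⟩

theorem exists_concat_prefix {v w : List Bool} (h : v <+: w) (hl : v.length < w.length) :
    ∃ c, v ++ [c] <+: w := by
  obtain ⟨u, rfl⟩ := h
  rcases u with _ | ⟨c, u⟩
  · simp at hl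
  · exact ⟨c, u, by simp⟩

theorem IsRay.image {L : Set (List Bool)} (hL : IsRay L) {φ : List Bool → List Bool}
    (hφ : IsSubst φ) : IsRay (imageLang φ L) where
  nil_mem := ⟨[], hL.nil_mem, List.nil_prefix⟩
  exists_concat := by
    rintro w ⟨v, hv, hw⟩
    obtain ⟨u, hu, hvu, hl⟩ := hL.exists_longer hv (w.length + 1)
    obtain ⟨c, hc⟩ := exists_concat_prefix (hw.trans (hφ.prefix_map hvu))
      (lt_of_lt_of_le hl (hφ.length_le u))
    exact ⟨c, u, hu, hc⟩
  prefix_mem := by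
    rintro v w h ⟨u, hu, hw⟩
    exact ⟨u, hu, h.trans hw⟩
  prefix_total := by
    rintro v w ⟨v', hv', hv⟩ ⟨w', hw', hw⟩
    rcases hL.prefix_total hv' hw' with h | h
    · exact List.prefix_or_prefix_of_prefix (hv.trans (hφ.prefix_map h)) hw
    · exact List.prefix_or_prefix_of_prefix hv (hw.trans (hφ.prefix_map h))

theorem IsRay.eq_of_cons_mem {L : Set (List Bool)} (hL : IsRay L) {c d : Bool} {v w : List Bool}
    (hv : c :: v ∈ L) (hw : d :: w ∈ L) : c = d := by
  rcases hL.prefix_total hv hw with h | h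
  · exact (List.cons_prefix_cons.1 h).1
  · exact (List.cons_prefix_cons.1 h).1.symm

/-! ### Prefixes of the form `P̃ ab P` -/

/-- The word `P̃ ab P`. -/
def mirror (P : List Bool) : List Bool := P.reverse ++ [true, false] ++ P

/-- The words `P` such that `P̃ ab P` lies in `L`. -/
def mirrors (L : Set (List Bool)) : Set (List Bool) := {P | mirror P ∈ L}

/-- With Q = E(P)b one has Q̃ ab Q = E(P̃ ab P)b. The last b costs nothing, since the image of
whichever letter follows begins with b. -/
theorem mirrors_subE {L : Set (List Bool)} (hL : IsRay L) :
    mirrors (imageLang subE L) = (fun P => subE P ++ [false]) '' mirrors L := by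
  ext Q
  constructor
  · rintro ⟨v, hv, y, h⟩
    rw [mirror] at h
    have hQ : ∃ Q', Q = Q' ++ [false] := by
      rcases List.eq_nil_or_concat' Q with rfl | ⟨Q', c, rfl⟩
      · rcases v with _ | ⟨c, v⟩
        · simp at h
        · cases c <;> simp at h
      · rcases v with _ | ⟨d, v⟩
        · simp at h
        · refine ⟨Q', ?_⟩
          cases c
          · rfl
          · cases d <;> simp at h
    obtain ⟨Q', rfl⟩ := hQ
    have hb : ∀ z, Q' ++ [false] ++ y ≠ true :: z := by
      intro z hz
      rcases Q' with _ | ⟨c, Q'⟩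
      · simp at hz
      · obtain rfl : c = true := by simpa using congrArg List.head? hz
        obtain ⟨z', hz'⟩ := subE_before_true (w := v) (x := false :: Q'.reverse ++ [true])
          (y := [false, true] ++ Q' ++ [false] ++ y) (by rw [← h]; simp)
        have := (List.append_inj' hz' rfl).2
        simp at this
    obtain ⟨v1, v2, rfl, h1, h2⟩ := subE_split (w := v) (x := false :: Q'.reverse ++ [true])
      (y := [false] ++ (Q' ++ [false] ++ y)) (by rw [← h]; simp) (by simp)
    obtain ⟨v3, v4, rfl, h3, h4⟩ := subE_split h2 hb
    obtain ⟨P, v5, rfl, rfl, -⟩ := subE_split (w := v4) (x := Q') (y := [false] ++ y)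
      (by rw [h4]; simp) (by simp)
    have h3' : v3 = [false] := subE_injective h3
    have h1' : v1 = P.reverse ++ [true] := by
      apply subE_injective
      rw [h1, cons_reverse_subE]
      simp
    refine ⟨P, hL.prefix_mem ⟨v5, ?_⟩ hv, rfl⟩
    rw [h3', h1', mirror]
    simp
  · rintro ⟨P, hP, rfl⟩
    obtain ⟨c, hc⟩ := hL.exists_concat _ hP
    refine ⟨_, hc, ?_⟩
    have := cons_reverse_subE P
    simp only [mirror, List.reverse_append, List.reverse_cons, List.reverse_nil, List.nil_append,
      List.cons_append, subE_append, subE_true, subE_false, List.append_assoc, this]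
    cases c
    · exact ⟨[], by simp⟩
    · exact ⟨[true], by simp⟩

/-- With Q = G(P)a one has Q̃ ab Q = G(P̃ ab P)a, and the image of the next letter begins with a.
The only mirrored prefix not of this form is ab itself, the image of an initial b. -/
theorem mirrors_subG {L : Set (List Bool)} (hL : IsRay L) :
    mirrors (imageLang subG L) =
      (fun P => subG P ++ [true]) '' mirrors L ∪ {P | P = [] ∧ [false] ∈ L} := by
  ext Q
  constructor
  · rintro ⟨v, hv, y, h⟩
    rw [mirror] at h
    rcases List.eq_nil_or_concat' Q with rfl | ⟨Q', c, rfl⟩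
    · right
      refine ⟨rfl, ?_⟩
      rcases v with _ | ⟨c, v⟩
      · simp at h
      cases c
      · exact hL.prefix_mem ⟨v, rfl⟩ hv
      · simp at h
        obtain ⟨z, hz⟩ := subG_before_false (x := []) h.symm
        simp at hz
    · left
      obtain rfl : c = true := by
        rcases v with _ | ⟨d, v⟩
        · simp at h
        · cases d <;> simp at h <;> exact h.1
      have hb : ∀ z, Q' ++ [true] ++ y ≠ false :: z := by
        intro z hz
        have := subG_letter_before_false (w := v) (x := true :: Q'.reverse ++ [true])
          (c := false) (y := z) (by
            rw [← h]
            simp only [List.reverse_append, List.reverse_cons, List.reverse_nil, List.nil_append,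
              List.append_assoc, List.cons_append] at hz ⊢
            rw [← hz])
        simp at this
      obtain ⟨v1, v2, rfl, h1, h2⟩ := subG_split (w := v) (x := true :: Q'.reverse)
        (y := [true, false] ++ (Q' ++ [true] ++ y)) (by rw [← h]; simp) (by simp)
      obtain ⟨v3, v4, rfl, h3, h4⟩ := subG_split h2 hb
      obtain ⟨P, v5, rfl, rfl, -⟩ := subG_split (w := v4) (x := Q') (y := [true] ++ y)
        (by rw [h4]; simp) (by simp)
      have h3' : v3 = [false] := subG_injective h3
      have h1' : v1 = P.reverse ++ [true] := by
        apply subG_injective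
        rw [h1, cons_reverse_subG]
        simp
      refine ⟨P, hL.prefix_mem ⟨v5, ?_⟩ hv, rfl⟩
      rw [h3', h1', mirror]
      simp
  · rintro (⟨P, hP, rfl⟩ | ⟨rfl, hP⟩)
    · obtain ⟨c, hc⟩ := hL.exists_concat _ hP
      refine ⟨_, hc, ?_⟩
      have := cons_reverse_subG P
      simp only [mirror, List.reverse_append, List.reverse_cons, List.reverse_nil,
        List.nil_append, List.cons_append, subG_append, subG_true, subG_false,
        List.append_assoc, this]
      cases c
      · exact ⟨[false], by simp⟩
      · exact ⟨[], by simp⟩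
    · exact ⟨_, hP, by simp [mirror]⟩

/-- With Q = G(P) one has Q̃ ab Q a = G'(P̃ ab P). The initial b rules out the prefix ab and forces
Q to end in b. -/
theorem mirrors_subG' {L : Set (List Bool)} (hL : IsRay L) (hf : [false] ∈ L) :
    mirrors (imageLang subG' L) = subG '' mirrors L := by
  ext Q
  constructor
  · rintro ⟨v, hv, y, h⟩
    rw [mirror] at h
    have hv' : ∃ v', v = false :: v' := by
      rcases v with _ | ⟨c, v'⟩
      · simp at h
      · exact ⟨v', by rw [hL.eq_of_cons_mem hv hf]⟩
    have hQ : ∃ Q', Q = Q' ++ [false] := by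
      obtain ⟨v', rfl⟩ := hv'
      rcases List.eq_nil_or_concat' Q with rfl | ⟨Q', c, rfl⟩
      · simp at h
      · simp at h
        exact ⟨Q', by rw [h.1]⟩
    obtain ⟨Q', rfl⟩ := hQ
    -- Prepending an a replaces the G'-image by a G-image, for which the cutting lemma is available.
    have h' := cons_subG' v
    rw [← h] at h'
    rcases List.eq_nil_or_concat' y with rfl | ⟨y', c, rfl⟩
    · have := (List.append_inj' (s₁ := true :: ((Q' ++ [false]).reverse ++ [true, false] ++ Q'))
        (t₁ := [false]) (s₂ := subG v) (t₂ := [true]) (by rw [← h']; simp) rfl).2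
      simp at this
    have hG : subG v = true :: (Q' ++ [false]).reverse ++ ([true, false] ++
        ((Q' ++ [false]) ++ y')) := by
      refine (List.append_inj' (t₁ := [true]) (t₂ := [c]) (h'.symm.trans ?_) rfl).1
      simp
    have hb : ∀ z, (Q' ++ [false]) ++ y' ≠ false :: z := by
      intro z hz
      have := subG_letter_before_false (w := v)
        (x := true :: (Q' ++ [false]).reverse ++ [true]) (c := false) (y := z) (by
          rw [hG, hz]; simp)
      simp at this
    have hy : ∀ z, y' ≠ false :: z := by
      rintro z rfl
      have := subG_letter_before_false (w := v)
        (x := true :: (Q' ++ [false]).reverse ++ [true, false] ++ Q') (c := false) (y := z) (by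
          rw [hG]; simp)
      simp at this
    obtain ⟨v1, v2, rfl, h1, h2⟩ := subG_split hG (by simp)
    obtain ⟨v3, v4, rfl, h3, h4⟩ := subG_split h2 hb
    obtain ⟨P, v5, rfl, hP, -⟩ := subG_split h4 hy
    rw [← hP] at h1
    have h3' : v3 = [false] := subG_injective h3
    have h1' : v1 = P.reverse ++ [true] := by
      apply subG_injective
      rw [h1, cons_reverse_subG]
      simp
    refine ⟨P, hL.prefix_mem ⟨v5, ?_⟩ hv, hP⟩
    rw [h3', h1', mirror]
    simp
  · rintro ⟨P, hP, rfl⟩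
    refine ⟨_, hP, [true], ?_⟩
    have := cons_subG' P
    simp [mirror, reverse_subG, this]

theorem encard_mirrors_subE {L : Set (List Bool)} (hL : IsRay L) :
    (mirrors (imageLang subE L)).encard = (mirrors L).encard := by
  rw [mirrors_subE hL, Function.Injective.encard_image]
  intro P Q h
  exact subE_injective (List.append_cancel_right h)

theorem encard_mirrors_subG_of_true {L : Set (List Bool)} (hL : IsRay L) (hf : [true] ∈ L) :
    (mirrors (imageLang subG L)).encard = (mirrors L).encard := by
  have : {P : List Bool | P = [] ∧ [false] ∈ L} = ∅ := by
    ext P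
    simp only [Set.mem_ofPred_eq, Set.mem_empty_iff_false, iff_false]
    rintro ⟨-, h⟩
    simpa using hL.eq_of_cons_mem hf h
  rw [mirrors_subG hL, this, Set.union_empty, Function.Injective.encard_image]
  intro P Q h
  exact subG_injective (List.append_cancel_right h)

theorem encard_mirrors_subG_of_false {L : Set (List Bool)} (hL : IsRay L) (hf : [false] ∈ L) :
    (mirrors (imageLang subG L)).encard = (mirrors L).encard + 1 := by
  have : {P : List Bool | P = [] ∧ [false] ∈ L} = {[]} := by
    ext P
    simp [hf]
  rw [mirrors_subG hL, this, Set.encard_union_eq, Function.Injective.encard_image,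
    Set.encard_singleton]
  · intro P Q h
    exact subG_injective (List.append_cancel_right h)
  · simp

/-! ### Blocks of substitutions -/

/-- The substitution `G ∘ E`, `G ∘ G ∘ E`, `G' ∘ E` or `G' ∘ G' ∘ E`. -/
def block : Bool → Bool → List Bool → List Bool
  | true, false => subG ∘ subE
  | true, true => subG ∘ subG ∘ subE
  | false, false => subG' ∘ subE
  | false, true => subG' ∘ subG' ∘ subE

theorem isSubst_block (g e : Bool) : IsSubst (block g e) := by
  cases g <;> cases e
  · exact isSubst_subG'.comp isSubst_subE
  · exact isSubst_subG'.comp (isSubst_subG'.comp isSubst_subE)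
  · exact isSubst_subG.comp isSubst_subE
  · exact isSubst_subG.comp (isSubst_subG.comp isSubst_subE)

theorem Admissible.block {w : List Bool} (h : Admissible w) (g e : Bool) :
    Admissible (block g e w) := by
  cases g <;> cases e
  · exact h.subE.subG'
  · exact h.subE.subG'.subG'
  · exact h.subE.subG
  · exact h.subE.subG.subG

theorem false_mem_imageLang_subE {L : Set (List Bool)} (hL : IsRay L) :
    [false] ∈ imageLang subE L := by
  obtain ⟨c, hc⟩ := hL.exists_concat _ hL.nil_mem
  refine ⟨_, hc, ?_⟩
  cases c <;> simp

theorem true_mem_imageLang_subG {L : Set (List Bool)} (hL : IsRay L) :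
    [true] ∈ imageLang subG L := by
  obtain ⟨c, hc⟩ := hL.exists_concat _ hL.nil_mem
  refine ⟨_, hc, ?_⟩
  cases c <;> simp

theorem false_mem_imageLang_subG' {L : Set (List Bool)} (hf : [false] ∈ L) :
    [false] ∈ imageLang subG' L :=
  ⟨_, hf, by simp⟩

/-- After E the word starts with b, so the first G adds one mirrored prefix; after that it starts
with a, so a second G adds none. -/
theorem encard_mirrors_block_true {L : Set (List Bool)} (hL : IsRay L) (e : Bool) :
    (mirrors (imageLang (block true e) L)).encard = (mirrors L).encard + 1 := by
  have hE := hL.image isSubst_subE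
  have hf := false_mem_imageLang_subE hL
  cases e
  · rw [block, imageLang_comp isSubst_subG, encard_mirrors_subG_of_false hE hf,
      encard_mirrors_subE hL]
  · rw [block, imageLang_comp isSubst_subG, imageLang_comp isSubst_subG,
      encard_mirrors_subG_of_true (hE.image isSubst_subG) (true_mem_imageLang_subG hE),
      encard_mirrors_subG_of_false hE hf, encard_mirrors_subE hL]

theorem exists_shorter_mirror {L : Set (List Bool)} (hL : IsRay L) (e : Bool) {Q : List Bool}
    (hQ : Q ∈ mirrors (imageLang (block false e) L)) :
    ∃ P ∈ mirrors L, P.length < Q.length := by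
  have hE := hL.image isSubst_subE
  have hf := false_mem_imageLang_subE hL
  have key : ∀ {M : Set (List Bool)}, IsRay M → [false] ∈ M → ∀ {R : List Bool},
      R ∈ mirrors (imageLang subG' M) → ∃ P ∈ mirrors M, P.length ≤ R.length := by
    intro M hM hfM R hR
    rw [mirrors_subG' hM hfM] at hR
    obtain ⟨P, hP, rfl⟩ := hR
    exact ⟨P, hP, length_le_subG P⟩
  have last : ∀ {R : List Bool}, R ∈ mirrors (imageLang subE L) →
      ∃ P ∈ mirrors L, P.length < R.length := by
    intro R hR
    rw [mirrors_subE hL] at hR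
    obtain ⟨P, hP, rfl⟩ := hR
    refine ⟨P, hP, ?_⟩
    have := length_le_subE P
    simp
    omega
  cases e
  · rw [block, imageLang_comp isSubst_subG'] at hQ
    obtain ⟨R, hR, h1⟩ := key hE hf hQ
    obtain ⟨P, hP, h2⟩ := last hR
    exact ⟨P, hP, by omega⟩
  · rw [block, imageLang_comp isSubst_subG', imageLang_comp isSubst_subG'] at hQ
    obtain ⟨R, hR, h1⟩ := key (hE.image isSubst_subG') (false_mem_imageLang_subG' hf) hQ
    obtain ⟨R', hR', h2⟩ := key hE hf hR
    obtain ⟨P, hP, h3⟩ := last hR'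
    exact ⟨P, hP, by omega⟩

/-! ### Infinite words directed by sequences of blocks -/

theorem two_mul_length_le_block (g e : Bool) (w : List Bool) :
    2 * w.length ≤ (block g e w).length := by
  induction w with
  | nil => simp
  | cons c w ih =>
    have h : ∀ g e c : Bool, 2 ≤ (block g e [c]).length := by decide
    have h := h g e c
    have := congrArg List.length ((isSubst_block g e).append [c] w)
    simp at this ⊢
    omega

/-- The composition of the first `m` blocks. -/
def iterBlock (g e : ℕ → Bool) : ℕ → List Bool → List Bool
  | 0, w => w
  | m + 1, w => iterBlock g e m (block (g m) (e m) w)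

theorem iterBlock_succ' (g e : ℕ → Bool) (m : ℕ) (w : List Bool) :
    iterBlock g e (m + 1) w =
      block (g 0) (e 0) (iterBlock (fun k => g (k + 1)) (fun k => e (k + 1)) m w) := by
  induction m generalizing w with
  | zero => rfl
  | succ m ih =>
    rw [iterBlock, ih]
    rfl

theorem isSubst_iterBlock (g e : ℕ → Bool) (m : ℕ) : IsSubst (iterBlock g e m) := by
  induction m with
  | zero => exact ⟨fun _ _ => rfl, fun _ => le_rfl⟩
  | succ m ih => exact ih.comp (isSubst_block (g m) (e m))

theorem le_length_iterBlock (g e : ℕ → Bool) (m : ℕ) {w : List Bool} (hw : w ≠ []) :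
    m ≤ (iterBlock g e m w).length := by
  have key : m + w.length ≤ (iterBlock g e m w).length := by
    induction m generalizing w with
    | zero => simp [iterBlock]
    | succ m ih =>
      have h1 := two_mul_length_le_block (g m) (e m) w
      have h2 := List.length_pos_of_ne_nil hw
      have h3 := ih (w := block (g m) (e m) w) (List.ne_nil_of_length_pos (by omega))
      rw [iterBlock]
      omega
  omega

theorem Admissible.iterBlock {w : List Bool} (h : Admissible w) (g e : ℕ → Bool) (m : ℕ) :
    Admissible (iterBlock g e m w) := by
  induction m generalizing w with
  | zero => exact h
  | succ m ih => exact ih (h.block _ _)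

theorem isRay_of_chain {F : ℕ → List Bool} (h : ∀ m, F m <+: F (m + 1))
    (hl : ∀ m, m ≤ (F m).length) : IsRay {w | ∃ m, w <+: F m} := by
  have mono : ∀ {m n}, m ≤ n → F m <+: F n := by
    intro m n hmn
    induction hmn with
    | refl => exact List.prefix_rfl
    | step _ ih => exact ih.trans (h _)
  refine ⟨⟨0, List.nil_prefix⟩, ?_, ?_, ?_⟩
  · rintro w ⟨m, hm⟩
    obtain ⟨c, hc⟩ := exists_concat_prefix (hm.trans (mono (le_max_left m (w.length + 1))))
      (lt_of_lt_of_le (lt_of_lt_of_le (Nat.lt_succ_self _) (le_max_right m _)) (hl _))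
    exact ⟨c, _, hc⟩
  · rintro v w hvw ⟨m, hm⟩
    exact ⟨m, hvw.trans hm⟩
  · rintro v w ⟨m, hm⟩ ⟨n, hn⟩
    exact List.prefix_or_prefix_of_prefix (hm.trans (mono (le_max_left m n)))
      (hn.trans (mono (le_max_right m n)))

/-- The prefixes of the infinite word directed by `g` and `e`. -/
def ray (g e : ℕ → Bool) : Set (List Bool) := {w | ∃ m, w <+: iterBlock g e m [g m]}

/-- Every image under a block with first index c begins with the letter c; this is why the seed at
level m is `g m`. -/
theorem iterBlock_prefix_succ (g e : ℕ → Bool) (m : ℕ) :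
    iterBlock g e m [g m] <+: iterBlock g e (m + 1) [g (m + 1)] := by
  apply (isSubst_iterBlock g e m).prefix_map
  generalize g m = c
  generalize g (m + 1) = d
  generalize e m = f
  revert c d f
  decide

/-- All blocks send a to a word ending in a, so the iterates of a also nest towards the left and
supply a past for the ray. -/
theorem iterBlock_suffix_succ (g e : ℕ → Bool) (m : ℕ) :
    iterBlock g e m [true] <:+ iterBlock g e (m + 1) [true] := by
  apply (isSubst_iterBlock g e m).suffix_map
  generalize g m = c
  generalize e m = f
  revert c f
  decide

theorem isRay_ray (g e : ℕ → Bool) : IsRay (ray g e) :=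
  isRay_of_chain (iterBlock_prefix_succ g e)
    fun m => le_length_iterBlock g e m (List.cons_ne_nil _ _)

theorem ray_eq_imageLang (g e : ℕ → Bool) :
    ray g e = imageLang (block (g 0) (e 0)) (ray (fun k => g (k + 1)) (fun k => e (k + 1))) := by
  ext w
  constructor
  · rintro ⟨m, hm⟩
    refine ⟨_, ⟨m, List.prefix_rfl⟩, ?_⟩
    rw [← iterBlock_succ' g e m]
    exact hm.trans (iterBlock_prefix_succ g e m)
  · rintro ⟨v, ⟨m, hm⟩, hw⟩
    refine ⟨m + 1, hw.trans ?_⟩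
    rw [iterBlock_succ']
    exact (isSubst_block _ _).prefix_map hm

theorem head_mem_ray (g e : ℕ → Bool) : [g 0] ∈ ray g e := ⟨0, List.prefix_rfl⟩

theorem mirrors_ray_eq_empty {g : ℕ → Bool} (hg : ∀ k, g k = false) (e : ℕ → Bool) :
    mirrors (ray g e) = ∅ := by
  have key : ∀ n : ℕ, ∀ e : ℕ → Bool, ∀ P ∈ mirrors (ray g e), P.length ≠ n := by
    intro n
    induction n using Nat.strong_induction_on with
    | _ n ih =>
      rintro e P hP rfl
      rw [ray_eq_imageLang, hg] at hP
      obtain ⟨Q, hQ, hl⟩ := exists_shorter_mirror (isRay_ray _ _) _ hP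
      have hg' : (fun k => g (k + 1)) = g := by
        funext k
        rw [hg, hg]
      rw [hg'] at hQ
      exact ih _ hl _ Q hQ rfl
  ext P
  simpa using fun hP => key _ e P hP rfl

theorem encard_mirrors_ray_succ {g : ℕ → Bool} (hg : g 0 = true) (e : ℕ → Bool) :
    (mirrors (ray g e)).encard =
      (mirrors (ray (fun k => g (k + 1)) (fun k => e (k + 1)))).encard + 1 := by
  rw [ray_eq_imageLang, hg, encard_mirrors_block_true (isRay_ray _ _)]

theorem encard_mirrors_ray_nat (n : ℕ) (e : ℕ → Bool) :
    (mirrors (ray (fun k => decide (k < n)) e)).encard = n := by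
  induction n generalizing e with
  | zero => rw [mirrors_ray_eq_empty (by simp)]; simp
  | succ n ih =>
    rw [encard_mirrors_ray_succ (by simp)]
    simp only [Nat.add_lt_add_iff_right]
    rw [ih]
    rfl

theorem encard_mirrors_ray_top (e : ℕ → Bool) :
    (mirrors (ray (fun _ => true) e)).encard = ⊤ := by
  refine ENat.eq_top_iff_forall_ge.2 fun n => ?_
  induction n generalizing e with
  | zero => simp
  | succ n ih =>
    rw [encard_mirrors_ray_succ rfl]
    push_cast
    gcongr
    exact ih _

/-! ### Long mirrored factors -/

theorem subE_mirror_mem {L : Set (List Bool)} (hL : IsRay L) {x P : List Bool}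
    (h : x ++ mirror P ∈ L) :
    ∃ Q, P.length < Q.length ∧ subE x ++ mirror Q ∈ imageLang subE L := by
  refine ⟨subE P ++ [false], ?_, ?_⟩
  · have := length_le_subE P
    simp
    omega
  · obtain ⟨c, hc⟩ := hL.exists_concat _ h
    refine ⟨_, hc, ?_⟩
    have := cons_reverse_subE P
    simp only [mirror, List.reverse_append, List.reverse_cons, List.reverse_nil, List.nil_append,
      List.cons_append, subE_append, subE_true, subE_false, List.append_assoc, this]
    cases c
    · exact ⟨[], by simp⟩
    · exact ⟨[true], by simp⟩

theorem subG_mirror_mem {L : Set (List Bool)} (hL : IsRay L) {x P : List Bool}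
    (h : x ++ mirror P ∈ L) :
    ∃ Q, P.length ≤ Q.length ∧ subG x ++ mirror Q ∈ imageLang subG L := by
  refine ⟨subG P ++ [true], ?_, ?_⟩
  · have := length_le_subG P
    simp
    omega
  · obtain ⟨c, hc⟩ := hL.exists_concat _ h
    refine ⟨_, hc, ?_⟩
    have := cons_reverse_subG P
    simp only [mirror, List.reverse_append, List.reverse_cons, List.reverse_nil, List.nil_append,
      List.cons_append, subG_append, subG_true, subG_false, List.append_assoc, this]
    cases c
    · exact ⟨[false], by simp⟩
    · exact ⟨[], by simp⟩

theorem subG'_mirror_mem {L : Set (List Bool)} {x P : List Bool} (h : x ++ mirror P ∈ L) :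
    ∃ Q, P.length ≤ Q.length ∧ subG' x ++ mirror Q ∈ imageLang subG' L := by
  refine ⟨subG P, length_le_subG P, _, h, [true], ?_⟩
  have := cons_subG' P
  simp [mirror, reverse_subG, this]

theorem block_mirror_mem {L : Set (List Bool)} (hL : IsRay L) (g e : Bool) {x P : List Bool}
    (h : x ++ mirror P ∈ L) :
    ∃ Q, P.length < Q.length ∧ block g e x ++ mirror Q ∈ imageLang (block g e) L := by
  have hE := hL.image isSubst_subE
  obtain ⟨Q, h1, hQ⟩ := subE_mirror_mem hL h
  cases g <;> cases e
  · obtain ⟨R, h2, hR⟩ := subG'_mirror_mem hQ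
    exact ⟨R, by omega, by rwa [block, imageLang_comp isSubst_subG']⟩
  · obtain ⟨R, h2, hR⟩ := subG'_mirror_mem hQ
    obtain ⟨S, h3, hS⟩ := subG'_mirror_mem hR
    exact ⟨S, by omega, by rwa [block, imageLang_comp isSubst_subG', imageLang_comp isSubst_subG']⟩
  · obtain ⟨R, h2, hR⟩ := subG_mirror_mem hE hQ
    exact ⟨R, by omega, by rwa [block, imageLang_comp isSubst_subG]⟩
  · obtain ⟨R, h2, hR⟩ := subG_mirror_mem hE hQ
    obtain ⟨S, h3, hS⟩ := subG_mirror_mem (hE.image isSubst_subG) hR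
    exact ⟨S, by omega, by rwa [block, imageLang_comp isSubst_subG, imageLang_comp isSubst_subG]⟩

/-- Every ray contains ab, the case of empty P, and each block turns a mirrored factor into one with
longer P. These factors make the values 3 approached from below. -/
theorem exists_long_mirror (g e : ℕ → Bool) (m : ℕ) :
    ∃ x P, m < x.length ∧ m ≤ P.length ∧ x ++ mirror P ∈ ray g e := by
  induction m generalizing g e with
  | zero =>
    have hL := isRay_ray (fun k => g (k + 1)) (fun k => e (k + 1))
    obtain ⟨c, hc⟩ := hL.exists_concat _ hL.nil_mem
    obtain ⟨d, hd⟩ := hL.exists_concat _ hc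
    -- The bound 6 only makes the search finite, so that the claim is decidable.
    have key : ∀ g e c d : Bool, ∃ k < 6, 0 < k ∧ k ≤ (block g e [c, d]).length ∧
        (block g e [c, d]).take k ++ [true, false] <+: block g e [c, d] := by
      decide
    obtain ⟨k, -, hk0, hk, hp⟩ := key (g 0) (e 0) c d
    refine ⟨(block (g 0) (e 0) [c, d]).take k, [], by simp; omega, le_rfl, ?_⟩
    rw [ray_eq_imageLang]
    exact ⟨_, hd, hp⟩
  | succ m ih =>
    obtain ⟨x, P, hx, hP, h⟩ := ih (fun k => g (k + 1)) (fun k => e (k + 1))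
    obtain ⟨Q, hQ, h'⟩ := block_mirror_mem (isRay_ray _ _) (g 0) (e 0) h
    refine ⟨_, Q, ?_, by omega, by rw [ray_eq_imageLang]; exact h'⟩
    have := two_mul_length_le_block (g 0) (e 0) x
    omega

/-! ### The directing sequence is determined by the word -/

theorem imageLang_subG_subset {L M : Set (List Bool)} (hL : IsRay L) (hM : IsRay M)
    (h : imageLang subG L ⊆ imageLang subG M) : L ⊆ M := by
  intro w hw
  obtain ⟨c, hc⟩ := hL.exists_concat w hw
  obtain ⟨v, hv, y, hy⟩ := h (mem_imageLang hc)
  obtain ⟨v1, v2, rfl, h1, -⟩ := subG_split (w := v) (x := subG w) (y := subG [c] ++ y)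
    (by rw [← hy]; simp) (by cases c <;> simp)
  rw [subG_injective h1] at hv
  exact hM.prefix_mem (List.prefix_append _ _) hv

theorem imageLang_subE_subset {L M : Set (List Bool)} (hL : IsRay L) (hM : IsRay M)
    (h : imageLang subE L ⊆ imageLang subE M) : L ⊆ M := by
  intro w hw
  obtain ⟨c, hc⟩ := hL.exists_concat w hw
  obtain ⟨v, hv, y, hy⟩ := h (mem_imageLang hc)
  obtain ⟨v1, v2, rfl, h1, -⟩ := subE_split (w := v) (x := subE w) (y := subE [c] ++ y)
    (by rw [← hy]; simp) (by cases c <;> simp)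
  rw [subE_injective h1] at hv
  exact hM.prefix_mem (List.prefix_append _ _) hv

/-- Conjugation by a reduces this to the case of G. -/
theorem imageLang_subG'_subset {L M : Set (List Bool)} (hL : IsRay L) (hM : IsRay M)
    (h : imageLang subG' L ⊆ imageLang subG' M) : L ⊆ M := by
  apply imageLang_subG_subset hL hM
  rintro w ⟨v, hv, hw⟩
  obtain ⟨v', hv', hp⟩ := h (mem_imageLang hv)
  refine ⟨v', hv', hw.trans ?_⟩
  have h1 : subG v ++ [true] <+: subG v' ++ [true] := by
    rw [← cons_subG', ← cons_subG']
    exact List.cons_prefix_cons.2 ⟨rfl, hp⟩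
  rcases List.prefix_concat_iff.1 h1 with h2 | h2
  · rw [List.append_cancel_right h2]
  · exact (List.prefix_append _ _).trans h2

theorem imageLang_block_subset {L M : Set (List Bool)} (hL : IsRay L) (hM : IsRay M) (g e : Bool)
    (h : imageLang (block g e) L ⊆ imageLang (block g e) M) : L ⊆ M := by
  apply imageLang_subE_subset hL hM
  have hE := hL.image isSubst_subE
  have hE' := hM.image isSubst_subE
  cases g <;> cases e
  · rw [block, imageLang_comp isSubst_subG', imageLang_comp isSubst_subG'] at h
    exact imageLang_subG'_subset hE hE' h
  · rw [block, imageLang_comp isSubst_subG', imageLang_comp isSubst_subG',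
      imageLang_comp isSubst_subG', imageLang_comp isSubst_subG'] at h
    exact imageLang_subG'_subset hE hE' (imageLang_subG'_subset (hE.image isSubst_subG')
      (hE'.image isSubst_subG') h)
  · rw [block, imageLang_comp isSubst_subG, imageLang_comp isSubst_subG] at h
    exact imageLang_subG_subset hE hE' h
  · rw [block, imageLang_comp isSubst_subG, imageLang_comp isSubst_subG,
      imageLang_comp isSubst_subG, imageLang_comp isSubst_subG] at h
    exact imageLang_subG_subset hE hE' (imageLang_subG_subset (hE.image isSubst_subG)
      (hE'.image isSubst_subG) h)

/-- The prefix of the word directed by `g`, `e` that reveals `e 0`. -/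
theorem marker_mem_ray {g : ℕ → Bool} (hg : g 0 = false → g 1 = false) (e : ℕ → Bool) :
    (bif g 0 then [true, e 0] else [false, true, e 0]) ∈ ray g e := by
  have hL := isRay_ray (fun k => g (k + 1)) (fun k => e (k + 1))
  have h0 := head_mem_ray (fun k => g (k + 1)) (fun k => e (k + 1))
  rw [ray_eq_imageLang]
  cases hg0 : g 0
  -- G'E sends b to ba, only two letters, so the third letter of the marker comes from the next
  -- letter of the tail. That the tail starts with b uses `g 1 = false`.
  · obtain ⟨d, hd⟩ := hL.exists_concat _ h0
    have key : ∀ f d : Bool, [false, true, f] <+: block false f [false, d] := by decide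
    simp only [zero_add, hg hg0] at hd
    exact ⟨_, hd, key (e 0) d⟩
  · have key : ∀ f c : Bool, [true, f] <+: block true f [c] := by decide
    exact ⟨_, h0, key (e 0) _⟩

theorem apply_zero_eq_of_ray_eq {g : ℕ → Bool} (hg : g 0 = false → g 1 = false) {e e' : ℕ → Bool}
    (h : ray g e = ray g e') : e 0 = e' 0 := by
  have h1 := marker_mem_ray hg e
  have h2 := marker_mem_ray hg e'
  rw [← h] at h2
  rcases (isRay_ray g e).prefix_total h1 h2 with h3 | h3
  · cases hg0 : g 0 <;> simp [hg0] at h3 <;> exact h3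
  · cases hg0 : g 0 <;> simp [hg0] at h3 <;> exact h3.symm

/-- The marker reveals `e 0`; the first block is then known and can be stripped off, and the
argument repeats on the tail. -/
theorem ray_injective {g : ℕ → Bool} (hg : ∀ k, g k = false → g (k + 1) = false) :
    Function.Injective (ray g) := by
  intro e e' h
  funext k
  induction k generalizing g e e' with
  | zero => exact apply_zero_eq_of_ray_eq (hg 0) h
  | succ k ih =>
    have h0 := apply_zero_eq_of_ray_eq (hg 0) h
    rw [ray_eq_imageLang, ray_eq_imageLang g e', h0] at h
    exact ih (g := fun k => g (k + 1)) (fun k => hg (k + 1))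
      (subset_antisymm (imageLang_block_subset (isRay_ray _ _) (isRay_ray _ _) _ _ h.subset)
      (imageLang_block_subset (isRay_ray _ _) (isRay_ray _ _) _ _ h.superset))

/-! ### From prefix languages to sequences -/

/-- The prefix of length `n` of a sequence. -/
def pre (s : ℕ → Bool) (n : ℕ) : List Bool := (List.range n).map s

@[simp] theorem length_pre (s : ℕ → Bool) (n : ℕ) : (pre s n).length = n := by simp [pre]

theorem pre_succ (s : ℕ → Bool) (n : ℕ) : pre s (n + 1) = pre s n ++ [s n] := by
  simp [pre, List.range_succ]

theorem IsRay.exists_seq {L : Set (List Bool)} (hL : IsRay L) :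
    ∃ s : ℕ → Bool, ∀ w, w ∈ L ↔ w = pre s w.length := by
  have hF : ∀ n : ℕ, ∃ w ∈ L, w.length = n := by
    intro n
    induction n with
    | zero => exact ⟨[], hL.nil_mem, rfl⟩
    | succ n ih =>
      obtain ⟨w, hw, hn⟩ := ih
      obtain ⟨c, hc⟩ := hL.exists_concat w hw
      exact ⟨_, hc, by simp [hn]⟩
  choose F hFL hFl using hF
  have huniq : ∀ {v w : List Bool}, v ∈ L → w ∈ L → v.length = w.length → v = w := by
    intro v w hv hw h
    rcases hL.prefix_total hv hw with h' | h'
    · exact h'.eq_of_length h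
    · exact (h'.eq_of_length h.symm).symm
  have hstep : ∀ n, ∃ c, F (n + 1) = F n ++ [c] := by
    intro n
    obtain ⟨c, hc⟩ := hL.exists_concat _ (hFL n)
    exact ⟨c, huniq (hFL _) hc (by simp [hFl])⟩
  choose s hs using hstep
  have hpre : ∀ n, pre s n = F n := by
    intro n
    induction n with
    | zero => exact (List.eq_nil_of_length_eq_zero (hFl 0)).symm
    | succ n ih => rw [pre_succ, ih, hs]
  refine ⟨s, fun w => ⟨fun hw => ?_, fun hw => ?_⟩⟩
  · rw [hpre]
    exact huniq hw (hFL _) (by rw [hFl])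
  · rw [hw, hpre]
    exact hFL _

/-- Every finite window of the two-sided word is a factor of the image of a two-letter word `[true,
g k]` under k blocks, hence admissible. -/
theorem exists_admissible_extension (g e : ℕ → Bool) :
    ∃ s l : ℕ → Bool, (∀ w, w ∈ ray g e ↔ w = pre s w.length) ∧
      ∀ m n, Admissible ((pre l m).reverse ++ pre s n) := by
  obtain ⟨s, hs⟩ := (isRay_ray g e).exists_seq
  obtain ⟨l, hl⟩ := (isRay_of_chain (F := fun m => (iterBlock g e m [true]).reverse)
    (fun m => List.reverse_prefix.2 (iterBlock_suffix_succ g e m))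
    (fun m => by simpa using le_length_iterBlock g e m (w := [true]) (by simp))).exists_seq
  refine ⟨s, l, hs, fun m n => ?_⟩
  obtain ⟨i, hi⟩ := (hs (pre s n)).2 (by simp)
  obtain ⟨j, hj⟩ := (hl (pre l m)).2 (by simp)
  have monoR : ∀ {i k}, i ≤ k → iterBlock g e i [g i] <+: iterBlock g e k [g k] := by
    intro i k hik
    induction hik with
    | refl => exact List.prefix_rfl
    | step _ ih => exact ih.trans (iterBlock_prefix_succ g e _)
  have monoL : ∀ {i k}, i ≤ k → iterBlock g e i [true] <:+ iterBlock g e k [true] := by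
    intro i k hik
    induction hik with
    | refl => exact List.suffix_rfl
    | step _ ih => exact ih.trans (iterBlock_suffix_succ g e _)
  have h := (admissible_pair true (g (max i j))).iterBlock g e (max i j)
  rw [show [true, g (max i j)] = [true] ++ [g (max i j)] from rfl,
    (isSubst_iterBlock g e _).append] at h
  obtain ⟨y, hy⟩ := hi.trans (monoR (le_max_left i j))
  obtain ⟨x, hx⟩ := (List.reverse_prefix.1 (by simpa using hj) :
    (pre l m).reverse <:+ _).trans (monoL (le_max_right i j))
  refine h.of_infix ⟨x, y, ?_⟩
  rw [← hx, ← hy]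
  simp

/-! ### Continued fractions and their convergents -/

/-- The `n`-th convergent of `[0; a 0, a 1, …]` has numerator `cfNum a (n + 1)`. -/
def cfNum (a : ℕ → ℕ+) : ℕ → ℕ
  | 0 => 1
  | 1 => 0
  | n + 2 => a n * cfNum a (n + 1) + cfNum a n

/-- The `n`-th convergent of `[0; a 0, a 1, …]` has denominator `cfDen a (n + 1)`. -/
def cfDen (a : ℕ → ℕ+) : ℕ → ℕ
  | 0 => 0
  | 1 => 1
  | n + 2 => a n * cfDen a (n + 1) + cfDen a n

/-- The value `[0; a 0, …, a (n - 1) + t]`. -/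
noncomputable def cfEval (a : ℕ → ℕ+) : ℕ → ℝ → ℝ
  | 0, t => t
  | n + 1, t => cfEval a n (1 / ((a n : ℕ) + t))

theorem cfEval_succ' (a : ℕ → ℕ+) (n : ℕ) (t : ℝ) :
    cfEval a (n + 1) t = 1 / ((a 0 : ℕ) + cfEval (fun i => a (i + 1)) n t) := by
  induction n generalizing t with
  | zero => rfl
  | succ n ih => rw [cfEval, ih]; rfl

theorem cfDen_pos (a : ℕ → ℕ+) (n : ℕ) : 0 < cfDen a (n + 1) := by
  induction n with
  | zero => exact Nat.one_pos
  | succ n ih => rw [cfDen]; have := (a n).pos; positivity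

theorem cfDen_le_succ (a : ℕ → ℕ+) (n : ℕ) : cfDen a n ≤ cfDen a (n + 1) := by
  rcases n with _ | n
  · exact Nat.zero_le _
  · rw [cfDen]
    have := (a n).pos
    nlinarith [cfDen_pos a n]

theorem add_le_cfDen (a : ℕ → ℕ+) (n : ℕ) : cfDen a (n + 1) + cfDen a n ≤ cfDen a (n + 2) := by
  rw [cfDen]
  have := (a n).pos
  nlinarith [cfDen_pos a n]

theorem cfNum_mul_cfDen (a : ℕ → ℕ+) (n : ℕ) :
    (cfNum a n : ℤ) * cfDen a (n + 1) - cfNum a (n + 1) * cfDen a n = (-1) ^ n := by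
  induction n with
  | zero => simp [cfNum, cfDen]
  | succ n ih =>
    rw [pow_succ, ← ih, cfNum, cfDen]
    push_cast
    ring

theorem cfEval_eq (a : ℕ → ℕ+) (n : ℕ) {t : ℝ} (ht : 0 ≤ t) :
    cfEval a n t = (cfNum a (n + 1) + t * cfNum a n) / (cfDen a (n + 1) + t * cfDen a n) := by
  induction n generalizing t with
  | zero => simp [cfEval, cfNum, cfDen]
  | succ n ih =>
    have ha : (0 : ℝ) < (a n : ℕ) := by exact_mod_cast (a n).pos
    have hQ : (0 : ℝ) < cfDen a (n + 1) := by exact_mod_cast cfDen_pos a n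
    have hQ' : (0 : ℝ) ≤ cfDen a n := by positivity
    rw [cfEval, ih (by positivity), cfNum, cfDen]
    push_cast
    have h1 : (0 : ℝ) < (a n : ℕ) + t := by positivity
    rw [div_eq_div_iff (by positivity) (by positivity)]
    field_simp
    ring

theorem cfEval_nonneg (a : ℕ → ℕ+) (n : ℕ) {t : ℝ} (ht : 0 ≤ t) : 0 ≤ cfEval a n t := by
  rw [cfEval_eq a n ht]
  positivity

theorem nums_eq (a : ℕ → ℕ+) (n : ℕ) : (contFrac 0 a).nums n = cfNum a (n + 1) := by
  induction n using Nat.twoStepInduction with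
  | zero => rw [nums_zero]; simp [cfNum]
  | one => simp [nums_one, cfNum]
  | more n h1 h2 => rw [nums_rec, h1, h2, cfNum.eq_3 a (n + 1)]; push_cast; rfl

theorem dens_eq (a₀ : ℤ) (a : ℕ → ℕ+) (n : ℕ) : (contFrac a₀ a).dens n = cfDen a (n + 1) := by
  induction n using Nat.twoStepInduction with
  | zero => rw [dens_zero]; simp [cfDen]
  | one => simp [dens_one, cfDen]
  | more n h1 h2 => rw [dens_rec, h1, h2, cfDen.eq_3 a (n + 1)]; push_cast; rfl

theorem nums_eq_add (a₀ : ℤ) (a : ℕ → ℕ+) (n : ℕ) :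
    (contFrac a₀ a).nums n = a₀ * (contFrac 0 a).dens n + (contFrac 0 a).nums n := by
  induction n using Nat.twoStepInduction with
  | zero => rw [nums_zero, nums_zero, dens_zero]; simp
  | one => simp [nums_one, dens_one, mul_comm]
  | more n h1 h2 => simp only [nums_rec, dens_rec, h1, h2]; ring

theorem convs_eq (a : ℕ → ℕ+) (n : ℕ) : (contFrac 0 a).convs n = cfEval a n 0 := by
  change (contFrac 0 a).nums n / (contFrac 0 a).dens n = _
  rw [cfEval_eq a n le_rfl, nums_eq, dens_eq]
  simp

theorem tendsto_cfEval (a : ℕ → ℕ+) :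
    Tendsto (fun n => cfEval a n 0) atTop (𝓝 (cfValue 0 a)) := by
  have := tendsto_convs 0 a
  exact this.congr (convs_eq a)

theorem cfValue_eq_add (a₀ : ℤ) (a : ℕ → ℕ+) : cfValue a₀ a = a₀ + cfValue 0 a := by
  refine tendsto_nhds_unique (tendsto_convs a₀ a) ?_
  refine ((tendsto_convs 0 a).const_add (a₀ : ℝ)).congr fun n => ?_
  change _ + (contFrac 0 a).nums n / (contFrac 0 a).dens n =
    (contFrac a₀ a).nums n / (contFrac a₀ a).dens n
  have h : (0 : ℝ) < (contFrac 0 a).dens n := by linarith [(dens_mono 0 a n).1]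
  rw [nums_eq_add a₀, dens_eq a₀, ← dens_eq 0]
  field_simp

theorem cfValue_nonneg (a : ℕ → ℕ+) : 0 ≤ cfValue 0 a :=
  ge_of_tendsto' (tendsto_cfEval a) fun n => cfEval_nonneg a n le_rfl

theorem cfValue_eq (a : ℕ → ℕ+) :
    cfValue 0 a = 1 / ((a 0 : ℕ) + cfValue 0 fun i => a (i + 1)) := by
  have ha : (0 : ℝ) < (a 0 : ℕ) := by exact_mod_cast (a 0).pos
  have h := (tendsto_cfEval a).comp (tendsto_add_atTop_nat 1)
  refine tendsto_nhds_unique h ?_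
  have h' := ((tendsto_cfEval fun i => a (i + 1)).const_add ((a 0 : ℕ) : ℝ)).inv₀
    (by have := cfValue_nonneg fun i => a (i + 1); positivity)
  simp only [one_div]
  refine h'.congr fun n => ?_
  simp [cfEval_succ']

theorem cfValue_pos (a : ℕ → ℕ+) : 0 < cfValue 0 a := by
  have ha : (0 : ℝ) < (a 0 : ℕ) := by exact_mod_cast (a 0).pos
  have := cfValue_nonneg fun i => a (i + 1)
  rw [cfValue_eq]
  positivity

theorem cfValue_lt_one (a : ℕ → ℕ+) : cfValue 0 a < 1 := by
  have ha : (1 : ℝ) ≤ (a 0 : ℕ) := by exact_mod_cast (a 0).pos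
  have := cfValue_pos fun i => a (i + 1)
  rw [cfValue_eq, div_lt_one (by positivity)]
  linarith

theorem cfValue_drop (a : ℕ → ℕ+) (n : ℕ) :
    cfValue 0 (fun i => a (n + i)) = 1 / ((a n : ℕ) + cfValue 0 fun i => a (n + 1 + i)) := by
  rw [cfValue_eq]
  simp only [add_zero, add_comm, add_left_comm]

theorem cfValue_eq_cfEval (a : ℕ → ℕ+) (n : ℕ) :
    cfValue 0 a = cfEval a n (cfValue 0 fun i => a (n + i)) := by
  induction n with
  | zero => simp [cfEval]
  | succ n ih => rw [cfEval, ih, cfValue_drop]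

/-- The `n`-th convergent of `[0; a 0, a 1, …]`. -/
def cfConv (a : ℕ → ℕ+) (n : ℕ) : ℚ := cfNum a (n + 1) / cfDen a (n + 1)

theorem cast_cfConv (a : ℕ → ℕ+) (n : ℕ) : (cfConv a n : ℝ) = cfEval a n 0 := by
  rw [cfEval_eq a n le_rfl, cfConv]
  push_cast
  simp

theorem den_cfConv (a : ℕ → ℕ+) (n : ℕ) : (cfConv a n).den = cfDen a (n + 1) := by
  have hc : IsCoprime (cfNum a (n + 1) : ℤ) (cfDen a (n + 1) : ℤ) := by
    have h := cfNum_mul_cfDen a n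
    have hs : ((-1 : ℤ) ^ n) * (-1) ^ n = 1 := by rw [← mul_pow]; simp
    refine ⟨-(-1) ^ n * cfDen a n, (-1) ^ n * cfNum a n, ?_⟩
    linear_combination (-1) ^ n * h + hs
  have := Rat.den_div_eq_of_coprime (a := (cfNum a (n + 1) : ℤ)) (b := (cfDen a (n + 1) : ℤ))
    (by exact_mod_cast cfDen_pos a n) (Int.isCoprime_iff_gcd_eq_one.1 hc)
  rw [cfConv]
  simp only [Int.cast_natCast] at this
  exact_mod_cast this

theorem convergent_nat_add (m : ℕ) (y : ℝ) (n : ℕ) :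
    ((m : ℝ) + y).convergent n = m + y.convergent n := by
  cases n <;> simp [add_assoc]

/-- Needed to apply Legendre's theorem, which is stated for `Real.convergent`. -/
theorem convergent_cfValue (a : ℕ → ℕ+) (n : ℕ) :
    (cfValue 0 a).convergent n = cfConv a n := by
  have h : ((cfValue 0 a).convergent n : ℝ) = cfConv a n := by
    rw [cast_cfConv]
    induction n generalizing a with
    | zero =>
      have : ⌊cfValue 0 a⌋ = 0 := Int.floor_eq_zero_iff.2 ⟨cfValue_nonneg a, cfValue_lt_one a⟩
      simp [this, cfEval]
    | succ n ih =>
      have h0 : ⌊cfValue 0 a⌋ = 0 := Int.floor_eq_zero_iff.2 ⟨cfValue_nonneg a, cfValue_lt_one a⟩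
      have h1 : Int.fract (cfValue 0 a) = cfValue 0 a := by simp [Int.fract, h0]
      rw [Real.convergent_succ, h0, h1, cfValue_eq, one_div, inv_inv, convergent_nat_add,
        cfEval_succ', ← ih]
      push_cast
      simp
  exact_mod_cast h

/-- The quality of the `n`-th convergent of `[0; a 0, a 1, …]`. -/
noncomputable def quality (a : ℕ → ℕ+) (n : ℕ) : ℝ :=
  (a n : ℕ) + cfValue 0 (fun i => a (n + 1 + i)) + (cfDen a n : ℝ) / cfDen a (n + 1)

theorem abs_sub_cfConv (a : ℕ → ℕ+) (n : ℕ) :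
    |cfValue 0 a - cfConv a n| = 1 / (quality a n * (cfDen a (n + 1) : ℝ) ^ 2) := by
  have ha : (0 : ℝ) < (a n : ℕ) := by exact_mod_cast (a n).pos
  have hQ : (0 : ℝ) < cfDen a (n + 1) := by exact_mod_cast cfDen_pos a n
  have hQ' : (0 : ℝ) ≤ cfDen a n := by positivity
  have ht := cfValue_pos fun i => a (n + i)
  have hdet : (cfNum a n : ℝ) * cfDen a (n + 1) - cfNum a (n + 1) * cfDen a n = (-1) ^ n := by
    exact_mod_cast cfNum_mul_cfDen a n
  have hq : quality a n = 1 / cfValue 0 (fun i => a (n + i)) + (cfDen a n : ℝ) / cfDen a (n + 1) := by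
    rw [quality, cfValue_drop a n, one_div_one_div]
  rw [cast_cfConv, cfEval_eq a n le_rfl, cfValue_eq_cfEval a n, cfEval_eq a n ht.le, hq]
  set t := cfValue 0 fun i => a (n + i)
  have h1 : ((cfNum a (n + 1) : ℝ) + t * cfNum a n) / (cfDen a (n + 1) + t * cfDen a n) -
      (cfNum a (n + 1) + 0 * cfNum a n) / (cfDen a (n + 1) + 0 * cfDen a n) =
      (-1) ^ n * (t / (cfDen a (n + 1) * (cfDen a (n + 1) + t * cfDen a n))) := by
    rw [← hdet]
    field_simp
    ring
  rw [h1, abs_mul, abs_pow, abs_neg, abs_one, one_pow, one_mul, abs_of_pos (by positivity)]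
  field_simp

theorem one_lt_quality (a : ℕ → ℕ+) (n : ℕ) : 1 < quality a n := by
  have ha : (1 : ℝ) ≤ (a n : ℕ) := by exact_mod_cast (a n).pos
  have := cfValue_pos fun i => a (n + 1 + i)
  have h : (0 : ℝ) ≤ (cfDen a n : ℝ) / cfDen a (n + 1) := by positivity
  rw [quality]
  linarith

theorem cfConv_mem_solutions (a : ℕ → ℕ+) (n : ℕ) {c : ℝ} (hc : 0 < c) :
    cfConv a n ∈ solutions c (cfValue 0 a) ↔ c < quality a n := by
  have hQ : (0 : ℝ) < cfDen a (n + 1) := by exact_mod_cast cfDen_pos a n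
  have hq := one_lt_quality a n
  change |cfValue 0 a - cfConv a n| < 1 / (c * ((cfConv a n).den : ℝ) ^ 2) ↔ _
  rw [abs_sub_cfConv, den_cfConv, one_div_lt_one_div (by positivity) (by positivity),
    mul_lt_mul_iff_left₀ (by positivity)]

/-- The errors strictly decrease. Denominators alone would not separate the convergents, as the
first two are both 1 when `a 0 = 1`. -/
theorem cfConv_injective (a : ℕ → ℕ+) : Function.Injective (cfConv a) := by
  have hanti : StrictAnti fun n => |cfValue 0 a - cfConv a n| := by
    refine strictAnti_nat_of_succ_lt fun n => ?_
    have key : ∀ n, quality a n * (cfDen a (n + 1) : ℝ) ^ 2 =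
        cfDen a (n + 1) * (cfDen a (n + 2) +
          cfValue 0 (fun i => a (n + 1 + i)) * cfDen a (n + 1)) := by
      intro n
      have hQ : (0 : ℝ) < cfDen a (n + 1) := by exact_mod_cast cfDen_pos a n
      rw [quality, cfDen]
      push_cast
      field_simp
      ring
    have hQ : (0 : ℝ) < cfDen a (n + 1) := by exact_mod_cast cfDen_pos a n
    have hQ2 : (cfDen a (n + 1) : ℝ) ≤ cfDen a (n + 2) := by exact_mod_cast cfDen_le_succ a (n + 1)
    have hQ3 : (cfDen a (n + 2) : ℝ) + cfDen a (n + 1) ≤ cfDen a (n + 3) := by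
      exact_mod_cast add_le_cfDen a (n + 1)
    have ht := cfValue_pos fun i => a (n + 1 + i)
    have ht1 := cfValue_lt_one fun i => a (n + 1 + i)
    have ht2 := cfValue_pos fun i => a (n + 1 + 1 + i)
    simp only [abs_sub_cfConv, key]
    apply one_div_lt_one_div_of_lt (by positivity)
    apply mul_lt_mul' hQ2 _ (by positivity) (by linarith)
    have : cfValue 0 (fun i => a (n + 1 + i)) * cfDen a (n + 1) < cfDen a (n + 1) := by
      nlinarith
    have : 0 < cfValue 0 (fun i => a (n + 1 + 1 + i)) * (cfDen a (n + 2) : ℝ) := by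
      have : (0 : ℝ) < cfDen a (n + 2) := by linarith
      positivity
    linarith
  intro m n h
  apply hanti.injective
  simp [h]

theorem solutions_cfValue (a : ℕ → ℕ+) {c : ℝ} (hc : 2 ≤ c) :
    solutions c (cfValue 0 a) = cfConv a '' {n | c < quality a n} := by
  ext r
  constructor
  · intro hr
    have hd : (0 : ℝ) < r.den := by exact_mod_cast r.pos
    have h2 : |cfValue 0 a - r| < 1 / (2 * (r.den : ℝ) ^ 2) := by
      refine lt_of_lt_of_le hr ?_
      gcongr
    obtain ⟨n, rfl⟩ := Real.exists_rat_eq_convergent h2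
    rw [convergent_cfValue] at hr ⊢
    exact ⟨n, (cfConv_mem_solutions a n (by linarith)).1 hr, rfl⟩
  · rintro ⟨n, hn, rfl⟩
    exact (cfConv_mem_solutions a n (by linarith)).2 hn

theorem irrational_cfValue (a : ℕ → ℕ+) : Irrational (cfValue 0 a) := by
  rw [← Real.infinite_rat_abs_sub_lt_one_div_den_sq_iff_irrational]
  refine (Set.infinite_range_of_injective (cfConv_injective a)).mono ?_
  rintro _ ⟨n, rfl⟩
  have := (cfConv_mem_solutions a n one_pos).2 (one_lt_quality a n)
  simpa [solutions] using this

theorem encard_solutions_cfValue (a : ℕ → ℕ+) {c : ℝ} (hc : 2 ≤ c) :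
    (solutions c (cfValue 0 a)).encard = {n | c < quality a n}.encard := by
  rw [solutions_cfValue a hc, (cfConv_injective a).encard_image]

theorem three_eq_coe : (3 : EReal) = ((3 : ℝ) : EReal) := rfl

theorem lagrangeValue_eq_three {a : ℕ → ℕ+} (h1 : ∀ c > 3, {n | c < quality a n}.Finite)
    (h2 : ∀ c < 3, {n | c < quality a n}.Infinite) : lagrangeValue (cfValue 0 a) = 3 := by
  rw [three_eq_coe]
  apply le_antisymm
  · refine iSup₂_le fun c hc => ?_
    by_contra! h
    have h3 : (3 : ℝ) < c := by exact_mod_cast h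
    refine hc.2 ?_
    rw [solutions_cfValue a (by linarith)]
    exact (h1 c h3).image _
  · refine le_of_forall_lt fun y hy => ?_
    -- Taking c above 2 keeps it in the range of Legendre's theorem.
    obtain ⟨c, hyc, hc⟩ := EReal.lt_iff_exists_real_btwn.1 (max_lt hy
      (EReal.coe_lt_coe_iff.2 (by norm_num : (2 : ℝ) < 3)))
    have hc3 : c < 3 := by exact_mod_cast hc
    have hc2 : 2 < c := by exact_mod_cast (le_max_right y ((2 : ℝ) : EReal)).trans_lt hyc
    refine ((le_max_left y _).trans_lt hyc).trans_le ?_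
    refine le_iSup₂_of_le c ⟨by linarith, ?_⟩ le_rfl
    rw [solutions_cfValue a hc2.le]
    exact (h2 c hc3).image (cfConv_injective a).injOn

/-! ### Doubled words -/

/-- The digit coded by a letter. -/
def digit (c : Bool) : ℕ+ := bif c then 2 else 1

/-- The sequence of digits in which each letter of `s` is coded by two equal digits. -/
def dbl (s : ℕ → Bool) : ℕ → ℕ+ := fun i => digit (s (i / 2))

/-- The value of the continued fraction coded by a sequence of letters. -/
noncomputable def val (s : ℕ → Bool) : ℝ := cfValue 0 (dbl s)

/-- The map `t ↦ [0; d, d + t]`, where `d` is the digit coded by `c`. -/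
noncomputable def step (c : Bool) (t : ℝ) : ℝ :=
  1 / ((digit c : ℕ) + 1 / ((digit c : ℕ) + t))

/-- The composition of the maps `step c` for the letters `c` of a word. -/
noncomputable def stepWord (w : List Bool) (t : ℝ) : ℝ := w.foldr step t

@[simp] theorem stepWord_nil (t : ℝ) : stepWord [] t = t := rfl

@[simp] theorem stepWord_cons (c : Bool) (w : List Bool) (t : ℝ) :
    stepWord (c :: w) t = step c (stepWord w t) := rfl

theorem stepWord_append (v w : List Bool) (t : ℝ) :
    stepWord (v ++ w) t = stepWord v (stepWord w t) :=
  List.foldr_append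

theorem digit_pos (c : Bool) : (0 : ℝ) < (digit c : ℕ) := by exact_mod_cast (digit c).pos

@[simp] theorem digit_true : ((digit true : ℕ) : ℝ) = 2 := by norm_num [digit]

@[simp] theorem digit_false : ((digit false : ℕ) : ℝ) = 1 := by norm_num [digit]

theorem step_true {t : ℝ} (ht : 0 ≤ t) : step true t = 1 / 2 - 1 / (10 + 4 * t) := by
  rw [step, digit_true]
  field_simp
  ring

theorem step_false {t : ℝ} (ht : 0 ≤ t) : step false t = 1 - 1 / (2 + t) := by
  rw [step, digit_false]
  field_simp
  ring

theorem step_pos (c : Bool) {t : ℝ} (ht : 0 ≤ t) : 0 < step c t := by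
  have := digit_pos c
  rw [step]
  positivity

theorem step_true_lt {t : ℝ} (ht : 0 ≤ t) : step true t < 1 / 2 := by
  rw [step_true ht]
  have : 0 < 1 / (10 + 4 * t) := by positivity
  linarith

theorem le_step_false {t : ℝ} (ht : 0 ≤ t) : 1 / 2 ≤ step false t := by
  rw [step_false ht]
  have : 1 / (2 + t) ≤ 1 / 2 := by gcongr; linarith
  linarith

theorem step_lt_one (c : Bool) {t : ℝ} (ht : 0 ≤ t) : step c t < 1 := by
  cases c
  · rw [step_false ht]
    have : 0 < 1 / (2 + t) := by positivity
    linarith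
  · linarith [step_true_lt ht]

/-- Each digit reverses the order, and a letter consists of two digits. -/
theorem step_strictMono (c : Bool) {t u : ℝ} (ht : 0 ≤ t) (h : t < u) : step c t < step c u := by
  have := digit_pos c
  have hu : 0 < u := ht.trans_lt h
  rw [step, step]
  gcongr

theorem abs_one_div_sub_le {t u : ℝ} (ht : 0 ≤ t) (hu : 0 ≤ u) :
    |1 / (2 + t) - 1 / (2 + u)| ≤ |t - u| / 4 := by
  have h : 1 / (2 + t) - 1 / (2 + u) = (u - t) / ((2 + t) * (2 + u)) := by
    field_simp
    ring
  rw [h, abs_div, abs_sub_comm u t, abs_of_pos (by positivity : 0 < (2 + t) * (2 + u))]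
  gcongr
  nlinarith [mul_nonneg ht hu]

theorem abs_step_sub_le (c : Bool) {t u : ℝ} (ht : 0 ≤ t) (hu : 0 ≤ u) :
    |step c t - step c u| ≤ |t - u| / 4 := by
  cases c
  · rw [step_false ht, step_false hu, sub_sub_sub_cancel_left, abs_sub_comm]
    exact abs_one_div_sub_le ht hu
  · have h : step true t - step true u = (t - u) / ((5 + 2 * t) * (5 + 2 * u)) := by
      rw [step_true ht, step_true hu]
      field_simp
      ring
    rw [h, abs_div, abs_of_pos (by positivity : 0 < (5 + 2 * t) * (5 + 2 * u))]
    gcongr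
    nlinarith [mul_nonneg ht hu]

theorem stepWord_nonneg (w : List Bool) {t : ℝ} (ht : 0 ≤ t) : 0 ≤ stepWord w t := by
  induction w with
  | nil => exact ht
  | cons c w ih => exact (step_pos c ih).le

theorem stepWord_le_one (w : List Bool) {t : ℝ} (ht : 0 ≤ t) (ht1 : t ≤ 1) :
    stepWord w t ≤ 1 := by
  rcases w with _ | ⟨c, w⟩
  · exact ht1
  · exact (step_lt_one c (stepWord_nonneg w ht)).le

theorem stepWord_strictMono (w : List Bool) {t u : ℝ} (ht : 0 ≤ t) (h : t < u) :
    stepWord w t < stepWord w u := by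
  induction w with
  | nil => exact h
  | cons c w ih => exact step_strictMono c (stepWord_nonneg w ht) ih

theorem abs_stepWord_sub_le (w : List Bool) {t u : ℝ} (ht : 0 ≤ t) (hu : 0 ≤ u) :
    |stepWord w t - stepWord w u| ≤ |t - u| / 4 ^ w.length := by
  induction w with
  | nil => simp
  | cons c w ih =>
    refine (abs_step_sub_le c (stepWord_nonneg w ht) (stepWord_nonneg w hu)).trans ?_
    rw [List.length_cons, pow_succ, ← div_div]
    gcongr

theorem val_pos (s : ℕ → Bool) : 0 < val s := cfValue_pos _

theorem val_lt_one (s : ℕ → Bool) : val s < 1 := cfValue_lt_one _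

theorem val_eq_step (s : ℕ → Bool) : val s = step (s 0) (val fun i => s (1 + i)) := by
  rw [val, cfValue_eq, cfValue_eq, step, val]
  have h : (fun i => dbl s (i + 1 + 1)) = dbl fun i => s (1 + i) := by
    funext i
    simp only [dbl]
    congr 2
    omega
  rw [h]
  rfl

theorem val_eq_stepWord (s : ℕ → Bool) (n : ℕ) :
    val s = stepWord (pre s n) (val fun i => s (n + i)) := by
  induction n with
  | zero => simp [pre]
  | succ n ih =>
    rw [ih, pre_succ, stepWord_append, val_eq_step]
    simp [add_assoc]

theorem pre_add (s : ℕ → Bool) (m n : ℕ) :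
    pre s (m + n) = pre s m ++ pre (fun i => s (m + i)) n := by
  induction n with
  | zero => simp [pre]
  | succ n ih => rw [← add_assoc, pre_succ, ih, pre_succ, List.append_assoc]

theorem val_eq_stepWord_succ (s : ℕ → Bool) (n : ℕ) :
    val s = stepWord (pre s n) (step (s n) (val fun i => s (n + 1 + i))) := by
  rw [val_eq_stepWord s (n + 1), pre_succ, stepWord_append]
  simp

/-- Lexicographic comparison with a < b: after the common prefix, 1/2 separates the values starting
with a from those starting with b. -/
theorem stepWord_lt_val {w : List Bool} {s : ℕ → Bool} {m : ℕ} {v : List Bool}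
    (hw : w = pre s m ++ true :: v) (hs : s m = false) {t : ℝ} (ht : 0 ≤ t) :
    stepWord w t < val s := by
  rw [val_eq_stepWord_succ s m, hw, hs, stepWord_append]
  refine stepWord_strictMono _ (stepWord_nonneg _ ht) ?_
  exact (step_true_lt (stepWord_nonneg _ ht)).trans_le (le_step_false (val_pos _).le)

theorem val_lt_stepWord {w : List Bool} {s : ℕ → Bool} {m : ℕ} {v : List Bool}
    (hw : w = pre s m ++ false :: v) (hs : s m = true) {t : ℝ} (ht : 0 ≤ t) :
    val s < stepWord w t := by
  rw [val_eq_stepWord_succ s m, hw, hs, stepWord_append]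
  refine stepWord_strictMono _ (step_pos _ (val_pos _).le).le ?_
  exact (step_true_lt (val_pos _).le).trans_le (le_step_false (stepWord_nonneg _ ht))

/-- A word that stops has tail 0, below any actual tail. This inequality is the sole source of
convergents of quality above 3. -/
theorem stepWord_zero_lt_val {w : List Bool} {s : ℕ → Bool} (hw : w = pre s w.length) :
    stepWord w 0 < val s := by
  rw [val_eq_stepWord s w.length, ← hw]
  exact stepWord_strictMono _ le_rfl (val_pos _)

theorem eq_pre_or_exists_ne (s : ℕ → Bool) (w : List Bool) :
    w = pre s w.length ∨ ∃ m c v, w = pre s m ++ c :: v ∧ c ≠ s m := by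
  induction w using List.reverseRecOn with
  | nil => exact Or.inl rfl
  | append_singleton w c ih =>
    rcases ih with ih | ⟨m, d, v, rfl, hd⟩
    · by_cases hc : c = s w.length
      · left
        rw [List.length_append, List.length_singleton, pre_succ, ← ih, hc]
      · exact Or.inr ⟨w.length, c, [], by rw [← ih], hc⟩
    · exact Or.inr ⟨m, d, v ++ [c], by simp, hd⟩

theorem exists_first_ne {r s : ℕ → Bool} (h : r ≠ s) : ∃ m, pre r m = pre s m ∧ r m ≠ s m := by
  by_contra! hcon
  have hpre : ∀ m, pre r m = pre s m := by
    intro m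
    induction m with
    | zero => rfl
    | succ m ih => rw [pre_succ, pre_succ, ih, hcon m ih]
  exact h (funext fun m => hcon m (hpre m))

theorem val_lt_val {r s : ℕ → Bool} {m : ℕ} (h : pre r m = pre s m) (hr : r m = true)
    (hs : s m = false) : val r < val s := by
  rw [val_eq_stepWord r (m + 1), pre_succ, h, hr]
  exact stepWord_lt_val rfl hs (val_pos _).le

theorem val_le_val {r s : ℕ → Bool}
    (h : ∀ m, pre r m = pre s m → ¬ (r m = false ∧ s m = true)) : val r ≤ val s := by
  by_cases hrs : r = s
  · rw [hrs]
  obtain ⟨m, hm, hne⟩ := exists_first_ne hrs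
  have := h m hm
  cases hr : r m <;> cases hs : s m <;> simp_all
  exact (val_lt_val hm hr hs).le

theorem val_injective : Function.Injective val := by
  intro r s h
  by_contra hrs
  obtain ⟨m, hm, hne⟩ := exists_first_ne hrs
  cases hr : r m <;> cases hs : s m <;> simp_all
  · exact absurd h (val_lt_val hm.symm hs hr).ne'
  · exact absurd h (val_lt_val hm hr hs).ne

/-! ### Heights at the two digits of a letter -/

/-- The height at the first digit of a letter `c`, where `t` and `u` are the values of the
words to the right and to the left of it. -/
noncomputable def heightFst (c : Bool) (t u : ℝ) : ℝ :=
  (digit c : ℕ) + 1 / ((digit c : ℕ) + t) + u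

/-- The height at the second digit of a letter `c`, where `t` and `u` are the values of the
words to the right and to the left of it. -/
noncomputable def heightSnd (c : Bool) (t u : ℝ) : ℝ :=
  (digit c : ℕ) + t + 1 / ((digit c : ℕ) + u)

theorem heightSnd_eq (c : Bool) (t u : ℝ) : heightSnd c t u = heightFst c u t := by
  rw [heightSnd, heightFst]
  ring

theorem heightFst_false_le {t u : ℝ} (ht : 0 ≤ t) (hu : u ≤ 1) : heightFst false t u ≤ 3 := by
  rw [heightFst, digit_false]
  have : 1 / (1 + t) ≤ 1 := by
    rw [div_le_one (by positivity)]
    linarith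
  linarith

theorem heightFst_true_le {t u : ℝ} (ht : 0 ≤ t) (hu : u ≤ 1 / 2) : heightFst true t u ≤ 3 := by
  rw [heightFst, digit_true]
  have : 1 / (2 + t) ≤ 1 / 2 := by
    gcongr
    linarith
  linarith

/-- As [0; 1, 1 + u] = 1 - 1/(2 + u), the integer parts add up to 3 and the rest only compares t
with u. -/
theorem heightFst_true_step_false (t : ℝ) {u : ℝ} (hu : 0 ≤ u) :
    heightFst true t (step false u) = 3 + (1 / (2 + t) - 1 / (2 + u)) := by
  rw [heightFst, digit_true, step_false hu]
  ring

theorem three_lt_heightFst_iff {t u : ℝ} (ht : 0 ≤ t) (hu : 0 ≤ u) :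
    3 < heightFst true t (step false u) ↔ t < u := by
  rw [heightFst_true_step_false t hu, lt_add_iff_pos_right, sub_pos,
    one_div_lt_one_div (by positivity) (by positivity), add_lt_add_iff_left]

theorem abs_heightFst_sub_three_le {t u : ℝ} (ht : 0 ≤ t) (hu : 0 ≤ u) :
    |heightFst true t (step false u) - 3| ≤ |t - u| := by
  rw [heightFst_true_step_false t hu, add_sub_cancel_left]
  refine (abs_one_div_sub_le ht hu).trans ?_
  linarith [abs_nonneg (t - u)]

/-! ### The qualities of the convergents of a doubled word -/

theorem cfDen_div_succ (a : ℕ → ℕ+) (n : ℕ) :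
    (cfDen a (n + 1) : ℝ) / cfDen a (n + 2) =
      1 / ((a n : ℕ) + (cfDen a n : ℝ) / cfDen a (n + 1)) := by
  have ha : (0 : ℝ) < (a n : ℕ) := by exact_mod_cast (a n).pos
  have hQ : (0 : ℝ) < cfDen a (n + 1) := by exact_mod_cast cfDen_pos a n
  have hQ' : (0 : ℝ) ≤ cfDen a n := by positivity
  rw [cfDen]
  push_cast
  field_simp

theorem dbl_two_mul (s : ℕ → Bool) (k : ℕ) : dbl s (2 * k) = digit (s k) := by
  rw [dbl]
  congr 2
  omega

theorem dbl_two_mul_add_one (s : ℕ → Bool) (k : ℕ) : dbl s (2 * k + 1) = digit (s k) := by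
  rw [dbl]
  congr 2
  omega

/-- A quotient of consecutive denominators is the continued fraction of the past read backwards; it
ends in 0 because `cfDen _ 0 = 0`. -/
theorem cfDen_dbl (s : ℕ → Bool) (k : ℕ) :
    (cfDen (dbl s) (2 * k) : ℝ) / cfDen (dbl s) (2 * k + 1) = stepWord (pre s k).reverse 0 := by
  induction k with
  | zero => simp [cfDen, pre]
  | succ k ih =>
    rw [pre_succ, List.reverse_append, List.reverse_singleton, List.singleton_append,
      stepWord_cons, ← ih, step, mul_add, mul_one, cfDen_div_succ (dbl s) (2 * k + 1),
      cfDen_div_succ (dbl s) (2 * k), dbl_two_mul, dbl_two_mul_add_one]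

theorem cfValue_dbl_drop (s : ℕ → Bool) (k : ℕ) :
    cfValue 0 (fun i => dbl s (2 * k + i)) = val fun i => s (k + i) := by
  rw [val]
  congr 1
  funext i
  simp only [dbl]
  congr 2
  omega

theorem quality_dbl_even (s : ℕ → Bool) (k : ℕ) :
    quality (dbl s) (2 * k) =
      heightFst (s k) (val fun i => s (k + 1 + i)) (stepWord (pre s k).reverse 0) := by
  rw [quality, cfDen_dbl, cfValue_drop, dbl_two_mul, dbl_two_mul_add_one, heightFst,
    show 2 * k + 1 + 1 = 2 * (k + 1) by ring, cfValue_dbl_drop]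

theorem quality_dbl_odd (s : ℕ → Bool) (k : ℕ) :
    quality (dbl s) (2 * k + 1) =
      heightSnd (s k) (val fun i => s (k + 1 + i)) (stepWord (pre s k).reverse 0) := by
  rw [quality, cfDen_div_succ, cfDen_dbl, dbl_two_mul, dbl_two_mul_add_one, heightSnd,
    show 2 * k + 1 + 1 = 2 * (k + 1) by ring, cfValue_dbl_drop]

/-- Only a ba matters. If the past runs out first, it is the smaller value, which is harmless here;
a first difference in the wrong direction would be a factor b P̃ ba P a. -/
theorem quality_dbl_even_le {s : ℕ → Bool} (hs : ∀ n, Admissible (pre s n)) (k : ℕ) :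
    quality (dbl s) (2 * k) ≤ 3 := by
  rw [quality_dbl_even]
  have ht := val_pos fun i => s (k + 1 + i)
  cases hk : s k
  · exact heightFst_false_le ht.le (stepWord_le_one _ le_rfl zero_le_one)
  rcases k with _ | k
  · exact heightFst_true_le ht.le (by simp [pre])
  rw [pre_succ, List.reverse_append, List.reverse_singleton, List.singleton_append, stepWord_cons]
  have hu := stepWord_nonneg (pre s k).reverse le_rfl
  cases hk' : s k
  · rw [← not_lt, three_lt_heightFst_iff ht.le hu, not_lt]
    rcases eq_pre_or_exists_ne (fun i => s (k + 1 + 1 + i)) (pre s k).reverse with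
      h | ⟨m, c, v, h, hc⟩
    · exact (stepWord_zero_lt_val h).le
    cases c
    · exfalso
      have hm : s (k + 1 + 1 + m) = true := by simpa using hc.symm
      refine (hs (k + 1 + 1 + m + 1)).2 ⟨pre (fun i => s (k + 1 + 1 + i)) m, v.reverse, [], ?_⟩
      rw [pre_succ, pre_add, pre_succ, pre_succ, hk, hk', hm]
      have := congrArg List.reverse h
      rw [List.reverse_reverse] at this
      rw [this]
      simp
    · have hm : s (k + 1 + 1 + m) = false := by simpa using hc.symm
      exact (stepWord_lt_val h hm le_rfl).le
  · exact heightFst_true_le ht.le (step_true_lt hu).le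

/-- Only an ab matters, and a smaller past now means quality above 3. A first difference giving this
would be a factor a P̃ ab P b, so the whole past must mirror the future. -/
theorem three_lt_quality_dbl_odd_iff {s : ℕ → Bool} (hs : ∀ n, Admissible (pre s n)) (k : ℕ) :
    3 < quality (dbl s) (2 * k + 1) ↔ s k = true ∧ s (k + 1) = false ∧
      (pre s k).reverse = pre (fun i => s (k + 2 + i)) k := by
  rw [quality_dbl_odd, heightSnd_eq]
  have hu := stepWord_nonneg (pre s k).reverse le_rfl
  cases hk : s k
  · simpa using heightFst_false_le hu (val_lt_one _).le
  rw [val_eq_step]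
  simp only [add_zero, ← add_assoc]
  have ht := val_pos fun i => s (k + 1 + 1 + i)
  cases hk' : s (k + 1)
  · rw [three_lt_heightFst_iff hu ht.le]
    simp only [true_and]
    constructor
    · intro hlt
      rcases eq_pre_or_exists_ne (fun i => s (k + 1 + 1 + i)) (pre s k).reverse with
        h | ⟨m, c, v, h, hc⟩
      · simpa using h
      exfalso
      cases c
      · have hm : s (k + 1 + 1 + m) = true := by simpa using hc.symm
        exact lt_asymm hlt (val_lt_stepWord h hm le_rfl)
      · have hm : s (k + 1 + 1 + m) = false := by simpa using hc.symm
        refine (hs (k + 1 + 1 + m + 1)).1 ⟨pre (fun i => s (k + 1 + 1 + i)) m, v.reverse, [], ?_⟩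
        rw [pre_succ, pre_add, pre_succ, pre_succ, hk, hk', hm]
        have := congrArg List.reverse h
        rw [List.reverse_reverse] at this
        rw [this]
        simp
    · intro h
      exact stepWord_zero_lt_val (by simpa using h)
  · simpa using heightFst_true_le hu (step_true_lt ht.le).le

/-- Past and future of the central ab agree along P, and each letter contracts distances by a factor
of at least 4. -/
theorem abs_quality_sub_three_le {s : ℕ → Bool} {x P : List Bool}
    (h : x ++ mirror P = pre s (x ++ mirror P).length) :
    |quality (dbl s) (2 * (x.length + P.length) + 1) - 3| ≤ 1 / 4 ^ P.length := by
  set k := x.length + P.length with hk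
  have hlen : (x ++ mirror P).length = k + 1 + 1 + P.length := by
    simp [mirror, hk]
    ring
  rw [hlen, pre_add, pre_succ, pre_succ] at h
  have h1 : (x ++ P.reverse) ++ ([true] ++ ([false] ++ P)) = pre s k ++ ([s k] ++
      ([s (k + 1)] ++ pre (fun i => s (k + 1 + 1 + i)) P.length)) := by
    simpa [mirror] using h
  obtain ⟨h2, h3⟩ := List.append_inj h1 (by simp [hk])
  obtain ⟨h3, h4⟩ := List.append_inj h3 rfl
  obtain ⟨h4, h5⟩ := List.append_inj h4 rfl
  have hsk : s k = true := by simpa using h3.symm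
  have hsk' : s (k + 1) = false := by simpa using h4.symm
  have hu : stepWord (pre s k).reverse 0 = stepWord P (stepWord x.reverse 0) := by
    rw [← h2, ← stepWord_append]
    simp
  have ht := val_pos fun i => s (k + 1 + 1 + i)
  have hx := stepWord_nonneg x.reverse le_rfl
  have hx1 := stepWord_le_one x.reverse le_rfl zero_le_one
  rw [quality_dbl_odd, heightSnd_eq, hsk, val_eq_step]
  simp only [add_zero, ← add_assoc]
  rw [hsk']
  refine (abs_heightFst_sub_three_le (stepWord_nonneg _ le_rfl) ht.le).trans ?_
  rw [hu, val_eq_stepWord _ P.length, ← h5]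
  refine (abs_stepWord_sub_le P hx (val_pos _).le).trans ?_
  gcongr
  rw [abs_le]
  constructor <;> linarith [val_pos fun i => s (k + 1 + 1 + (P.length + i)),
    val_lt_one fun i => s (k + 1 + 1 + (P.length + i))]

/-! ### Counting the good convergents -/

theorem mirror_eq_pre_iff {s : ℕ → Bool} {P : List Bool} :
    mirror P = pre s (mirror P).length ↔ s P.length = true ∧ s (P.length + 1) = false ∧
      (pre s P.length).reverse = P ∧ P = pre (fun i => s (P.length + 2 + i)) P.length := by
  have hlen : (mirror P).length = P.length + 1 + 1 + P.length := by
    simp [mirror]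
    ring
  rw [hlen, pre_add, pre_succ, pre_succ]
  constructor
  · intro h
    have h1 : P.reverse ++ ([true] ++ ([false] ++ P)) = pre s P.length ++ ([s P.length] ++
        ([s (P.length + 1)] ++ pre (fun i => s (P.length + 1 + 1 + i)) P.length)) := by
      simpa [mirror] using h
    obtain ⟨h2, h3⟩ := List.append_inj h1 (by simp)
    obtain ⟨h3, h4⟩ := List.append_inj h3 rfl
    obtain ⟨h4, h5⟩ := List.append_inj h4 rfl
    exact ⟨by simpa using h3.symm, by simpa using h4.symm, by rw [← h2, List.reverse_reverse], h5⟩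
  · rintro ⟨h1, h2, h3, h4⟩
    rw [h1, h2, mirror]
    have h3' := congrArg List.reverse h3
    rw [List.reverse_reverse] at h3'
    rw [h3']
    simp only [List.append_assoc, List.cons_append, List.nil_append]
    congr 3

theorem encard_three_lt_quality {s : ℕ → Bool} {L : Set (List Bool)}
    (hL : ∀ w, w ∈ L ↔ w = pre s w.length) (hs : ∀ n, Admissible (pre s n)) :
    {n | 3 < quality (dbl s) n}.encard = (mirrors L).encard := by
  set K : Set ℕ := {k | s k = true ∧ s (k + 1) = false ∧
    (pre s k).reverse = pre (fun i => s (k + 2 + i)) k} with hK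
  have h1 : {n | 3 < quality (dbl s) n} = (fun k => 2 * k + 1) '' K := by
    ext n
    constructor
    · intro hn
      obtain ⟨k, rfl | rfl⟩ := Nat.even_or_odd' n
      · exact absurd (quality_dbl_even_le hs k) (not_le.2 hn)
      · exact ⟨k, (three_lt_quality_dbl_odd_iff hs k).1 hn, rfl⟩
    · rintro ⟨k, hk, rfl⟩
      exact (three_lt_quality_dbl_odd_iff hs k).2 hk
  have h2 : mirrors L = (fun k => pre (fun i => s (k + 2 + i)) k) '' K := by
    ext P
    constructor
    · intro hP
      obtain ⟨h1, h2, h3, h4⟩ := mirror_eq_pre_iff.1 ((hL _).1 hP)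
      exact ⟨P.length, ⟨h1, h2, h3.trans h4⟩, h4.symm⟩
    · rintro ⟨k, ⟨h1, h2, h3⟩, rfl⟩
      refine (hL _).2 (mirror_eq_pre_iff.2 ?_)
      simpa using ⟨h1, h2, h3⟩
  have hinj : Function.Injective fun k => pre (fun i => s (k + 2 + i)) k := by
    intro k k' h
    simpa using congrArg List.length h
  rw [h1, h2, hinj.encard_image, Function.Injective.encard_image]
  intro k k' h
  simpa using h

theorem exists_one_div_four_pow_lt {c : ℝ} (hc : 0 < c) (m : ℕ) :
    ∃ M ≥ m, ∀ k ≥ M, 1 / (4 : ℝ) ^ k < c := by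
  obtain ⟨N, hN⟩ := exists_pow_lt_of_lt_one hc (by norm_num : (1 / 4 : ℝ) < 1)
  refine ⟨max m N, le_max_left _ _, fun k hk => ?_⟩
  rw [← one_div_pow]
  exact (pow_le_pow_of_le_one (by norm_num) (by norm_num)
    ((le_max_right _ _).trans hk)).trans_lt hN

/-- A quality above 3 at letter k comes from a mirrored prefix with P of length k, so it exceeds 3
by at most 4^(-k). -/
theorem finite_lt_quality {s : ℕ → Bool} (hs : ∀ n, Admissible (pre s n)) {c : ℝ} (hc : 3 < c) :
    {n | c < quality (dbl s) n}.Finite := by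
  obtain ⟨M, -, hM⟩ := exists_one_div_four_pow_lt (sub_pos.2 hc) 0
  refine (Set.finite_lt_nat (2 * M + 1)).subset fun n hn => ?_
  have hn : c < quality (dbl s) n := hn
  obtain ⟨k, rfl | rfl⟩ := Nat.even_or_odd' n
  · linarith [quality_dbl_even_le hs k]
  · obtain ⟨h1, h2, h3⟩ := (three_lt_quality_dbl_odd_iff hs k).1 (hc.trans hn)
    have h := mirror_eq_pre_iff (s := s) (P := pre (fun i => s (k + 2 + i)) k)
    have h' := abs_quality_sub_three_le (s := s) (x := [])
      (P := pre (fun i => s (k + 2 + i)) k) (by simpa using h.2 (by simpa using ⟨h1, h2, h3⟩))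
    simp only [List.length_nil, zero_add, length_pre] at h'
    by_contra hk
    have hk : ¬ (2 * k + 1 < 2 * M + 1) := hk
    linarith [hM k (by omega), (abs_le.1 h').2]

theorem infinite_lt_quality {g e : ℕ → Bool} {s : ℕ → Bool}
    (hL : ∀ w, w ∈ ray g e ↔ w = pre s w.length) {c : ℝ} (hc : c < 3) :
    {n | c < quality (dbl s) n}.Infinite := by
  refine Set.infinite_of_forall_exists_gt fun m => ?_
  obtain ⟨M, hm, hM⟩ := exists_one_div_four_pow_lt (sub_pos.2 hc) m
  obtain ⟨x, P, hx, hP, h⟩ := exists_long_mirror g e M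
  have h' := abs_quality_sub_three_le ((hL _).1 h)
  refine ⟨_, ?_, (by omega : m < 2 * (x.length + P.length) + 1)⟩
  change c < _
  linarith [hM _ hP, (abs_le.1 h').1]

/-! ### The bi-infinite word -/

/-- The bi-infinite sequence of letters with right half `s` and reversed left half `l`. -/
def glue (s l : ℕ → Bool) : ℤ → Bool
  | Int.ofNat i => s i
  | Int.negSucc i => l i

/-- The letters of `β` from position `k` on. -/
def rightOf (β : ℤ → Bool) (k : ℤ) : ℕ → Bool := fun i => β (k + i)

/-- The letters of `β` before position `k`, from right to left. -/
def leftOf (β : ℤ → Bool) (k : ℤ) : ℕ → Bool := fun i => β (k - 1 - i)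

theorem reverse_pre_leftOf (β : ℤ → Bool) (k : ℤ) (m : ℕ) :
    (pre (leftOf β k) m).reverse = pre (rightOf β (k - m)) m := by
  induction m with
  | zero => rfl
  | succ m ih =>
    rw [pre_succ, List.reverse_append, ih, add_comm m 1, pre_add, List.reverse_singleton]
    congr 1
    · simp [pre, leftOf, rightOf]
      congr 1
      ring
    · congr 1
      funext i
      simp only [rightOf]
      congr 1
      push_cast
      ring

theorem pre_rightOf_add (β : ℤ → Bool) (k : ℤ) (m n : ℕ) :
    pre (rightOf β k) (m + n) = pre (rightOf β k) m ++ pre (rightOf β (k + m)) n := by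
  rw [pre_add]
  congr 2
  funext i
  simp only [rightOf]
  congr 1
  push_cast
  ring

theorem admissible_glue {s l : ℕ → Bool}
    (h : ∀ m n, Admissible ((pre l m).reverse ++ pre s n)) (k : ℤ) (n : ℕ) :
    Admissible (pre (rightOf (glue s l) k) n) := by
  have hr : rightOf (glue s l) 0 = s := by
    funext i
    simp only [rightOf, zero_add]
    rfl
  have hl : leftOf (glue s l) 0 = l := by
    funext i
    simp only [leftOf]
    rw [show (0 : ℤ) - 1 - i = Int.negSucc i by rw [Int.negSucc_eq]; ring]
    rfl
  -- The window from k to k + n lies inside the window from -|k| to |k| + n, which straddles the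
  -- origin.
  obtain ⟨i, hi⟩ : ∃ i : ℕ, -(k.natAbs : ℤ) + i = k := ⟨(k + k.natAbs).toNat, by omega⟩
  have h1 := h k.natAbs (k.natAbs + n)
  have h2 := reverse_pre_leftOf (glue s l) 0 k.natAbs
  have h3 := pre_rightOf_add (glue s l) (0 - k.natAbs) k.natAbs (k.natAbs + n)
  rw [sub_add_cancel, ← h2, hl, hr] at h3
  rw [← h3] at h1
  obtain ⟨j, hj⟩ : ∃ j, k.natAbs + (k.natAbs + n) = i + n + j := ⟨2 * k.natAbs - i, by omega⟩
  rw [hj, pre_rightOf_add, pre_rightOf_add, zero_sub, hi] at h1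
  exact h1.of_infix ⟨_, _, rfl⟩

/-- The bi-infinite word of digits coded by a bi-infinite sequence of letters. -/
def biDbl (β : ℤ → Bool) : BiWord := fun i => digit (β (i / 2))

theorem height_eq (w : BiWord) : height w = ((w 0 : ℕ) : ℝ) +
    cfValue 0 (fun i : ℕ => w ((i : ℤ) + 1)) + cfValue 0 (fun i : ℕ => w (-((i : ℤ) + 1))) := by
  rw [height, cfValue_eq_add]
  push_cast
  rfl

theorem height_biDbl_even (β : ℤ → Bool) (k : ℤ) :
    height (shift (2 * k) (biDbl β)) =
      heightFst (β k) (val (rightOf β (k + 1))) (val (leftOf β k)) := by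
  have h0 : shift (2 * k) (biDbl β) 0 = digit (β k) := by
    simp only [shift, biDbl]
    congr 2
    omega
  have h1 : cfValue 0 (fun i : ℕ => shift (2 * k) (biDbl β) ((i : ℤ) + 1)) =
      1 / ((digit (β k) : ℕ) + val (rightOf β (k + 1))) := by
    rw [cfValue_eq, val]
    congr 4
    · simp only [shift, biDbl]
      congr 2
      omega
    · funext i
      simp only [shift, biDbl, dbl, rightOf]
      congr 2
      omega
  have h2 : cfValue 0 (fun i : ℕ => shift (2 * k) (biDbl β) (-((i : ℤ) + 1))) =
      val (leftOf β k) := by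
    rw [val]
    congr 1
    funext i
    simp only [shift, biDbl, dbl, leftOf]
    congr 2
    omega
  rw [height_eq, h0, h1, h2, heightFst]

theorem height_biDbl_odd (β : ℤ → Bool) (k : ℤ) :
    height (shift (2 * k + 1) (biDbl β)) =
      heightSnd (β k) (val (rightOf β (k + 1))) (val (leftOf β k)) := by
  have h0 : shift (2 * k + 1) (biDbl β) 0 = digit (β k) := by
    simp only [shift, biDbl]
    congr 2
    omega
  have h1 : cfValue 0 (fun i : ℕ => shift (2 * k + 1) (biDbl β) ((i : ℤ) + 1)) =
      val (rightOf β (k + 1)) := by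
    rw [val]
    congr 1
    funext i
    simp only [shift, biDbl, dbl, rightOf]
    congr 2
    omega
  have h2 : cfValue 0 (fun i : ℕ => shift (2 * k + 1) (biDbl β) (-((i : ℤ) + 1))) =
      1 / ((digit (β k) : ℕ) + val (leftOf β k)) := by
    rw [cfValue_eq, val]
    congr 4
    · simp only [shift, biDbl]
      congr 2
      omega
    · funext i
      simp only [shift, biDbl, dbl, leftOf]
      congr 2
      omega
  rw [height_eq, h0, h1, h2, heightSnd]

theorem val_leftOf (β : ℤ → Bool) (k : ℤ) :
    val (leftOf β k) = step (β (k - 1)) (val (leftOf β (k - 1))) := by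
  rw [val_eq_step]
  congr 2
  · simp [leftOf]
  · funext i
    simp only [leftOf]
    congr 1
    push_cast
    ring

theorem val_rightOf (β : ℤ → Bool) (k : ℤ) :
    val (rightOf β k) = step (β k) (val (rightOf β (k + 1))) := by
  rw [val_eq_step]
  congr 2
  · simp [rightOf]
  · funext i
    simp only [rightOf]
    congr 1
    push_cast
    ring

/-- Exhibits the letters around positions k and k + 1 in the shape of a forbidden factor, with m the
place of the first difference. -/
theorem pre_around (β : ℤ → Bool) (k : ℤ) (m : ℕ) :
    pre (rightOf β (k - (m + 1 : ℕ))) (m + 1 + (2 + (m + 1))) =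
      leftOf β k m :: (pre (leftOf β k) m).reverse ++ [β k, β (k + 1)] ++
        pre (rightOf β (k + 2)) m ++ [rightOf β (k + 2) m] := by
  rw [pre_rightOf_add, ← reverse_pre_leftOf, sub_add_cancel, pre_rightOf_add, pre_succ, pre_succ]
  simp [pre, List.range_succ, rightOf]

theorem height_biDbl_le {β : ℤ → Bool} (hβ : ∀ k n, Admissible (pre (rightOf β k) n)) (n : ℤ) :
    height (shift n (biDbl β)) ≤ 3 := by
  obtain ⟨k, rfl | rfl⟩ := Int.even_or_odd' n
  · rw [height_biDbl_even]
    have ht := val_pos (rightOf β (k + 1))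
    cases hk : β k
    · exact heightFst_false_le ht.le (val_lt_one _).le
    rw [val_leftOf]
    have hu := val_pos (leftOf β (k - 1))
    cases hk' : β (k - 1)
    · rw [← not_lt, three_lt_heightFst_iff ht.le hu.le, not_lt]
      refine val_le_val fun m hm ⟨h1, h2⟩ => ?_
      refine (hβ (k - 1 - (m + 1 : ℕ)) (m + 1 + (2 + (m + 1)))).2
        ⟨pre (leftOf β (k - 1)) m, [], [], ?_⟩
      rw [pre_around, h1, hk', sub_add_cancel, hk, show k - 1 + 2 = k + 1 by ring, h2, hm]
      simp
    · exact heightFst_true_le ht.le (step_true_lt hu.le).le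
  · rw [height_biDbl_odd, heightSnd_eq]
    have hu := val_pos (leftOf β k)
    cases hk : β k
    · exact heightFst_false_le hu.le (val_lt_one _).le
    rw [val_rightOf]
    have ht := val_pos (rightOf β (k + 1 + 1))
    cases hk' : β (k + 1)
    · rw [← not_lt, three_lt_heightFst_iff hu.le ht.le, not_lt]
      refine val_le_val fun m hm ⟨h1, h2⟩ => ?_
      rw [add_assoc] at h1 hm
      refine (hβ (k - (m + 1 : ℕ)) (m + 1 + (2 + (m + 1)))).1
        ⟨pre (leftOf β k) m, [], [], ?_⟩
      rw [pre_around, h2, hk', hk]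
      simp only [one_add_one_eq_two] at h1 hm
      rw [h1, hm]
      simp
    · exact heightFst_true_le hu.le (step_true_lt ht.le).le

/-- The mirrored factor lies in the right half, so the left half `l` plays no role in the bound. -/
theorem abs_height_sub_three_le {s l : ℕ → Bool} {x P : List Bool}
    (h : x ++ mirror P = pre s (x ++ mirror P).length) :
    |height (shift (2 * (x.length + P.length : ℕ) + 1) (biDbl (glue s l))) - 3| ≤
      1 / 4 ^ P.length := by
  set k := x.length + P.length with hk
  have hlen : (x ++ mirror P).length = k + 1 + 1 + P.length := by
    simp [mirror, hk]
    ring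
  rw [hlen, pre_add, pre_succ, pre_succ] at h
  have h1 : (x ++ P.reverse) ++ ([true] ++ ([false] ++ P)) = pre s k ++ ([s k] ++
      ([s (k + 1)] ++ pre (fun i => s (k + 1 + 1 + i)) P.length)) := by
    simpa [mirror] using h
  obtain ⟨h2, h3⟩ := List.append_inj h1 (by simp [hk])
  obtain ⟨h3, h4⟩ := List.append_inj h3 rfl
  obtain ⟨h4, h5⟩ := List.append_inj h4 rfl
  have hsk : glue s l k = true := by
    have : s k = true := by simpa using h3.symm
    exact this
  have hsk' : glue s l (k + 1) = false := by
    have : s (k + 1) = false := by simpa using h4.symm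
    exact this
  have hR : rightOf (glue s l) ((k : ℤ) + 1 + 1) = fun i => s (k + 1 + 1 + i) := by
    funext i
    exact congrArg (glue s l) (by push_cast; rfl : (k : ℤ) + 1 + 1 + i = ((k + 1 + 1 + i : ℕ) : ℤ))
  have hLk : (pre (leftOf (glue s l) k) k).reverse = pre s k := by
    rw [reverse_pre_leftOf, sub_self]
    congr 1
    funext i
    simp only [rightOf, zero_add]
    rfl
  have hL : pre (leftOf (glue s l) k) P.length = P := by
    have := congrArg List.reverse (hLk.trans h2.symm)
    have hk' : pre (leftOf (glue s l) k) k = pre (leftOf (glue s l) k) (P.length + x.length) := by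
      rw [hk, add_comm x.length]
    rw [List.reverse_reverse, hk', pre_add] at this
    simp only [List.reverse_append, List.reverse_reverse] at this
    exact (List.append_inj this (by simp)).1
  rw [height_biDbl_odd, heightSnd_eq, hsk, val_rightOf, hsk']
  refine (abs_heightFst_sub_three_le (val_pos _).le (val_pos _).le).trans ?_
  rw [val_eq_stepWord (leftOf _ _) P.length, val_eq_stepWord (rightOf _ _) P.length, hL, hR, ← h5]
  refine (abs_stepWord_sub_le P (val_pos _).le (val_pos _).le).trans ?_
  gcongr
  rw [abs_le]
  constructor <;> linarith [val_pos fun i => s (k + 1 + 1 + (P.length + i)),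
    val_lt_one fun i => s (k + 1 + 1 + (P.length + i)),
    val_pos fun i => leftOf (glue s l) k (P.length + i),
    val_lt_one fun i => leftOf (glue s l) k (P.length + i)]

theorem markovValue_eq_three {g e : ℕ → Bool} {s l : ℕ → Bool}
    (hL : ∀ w, w ∈ ray g e ↔ w = pre s w.length)
    (h : ∀ m n, Admissible ((pre l m).reverse ++ pre s n)) :
    markovValue (biDbl (glue s l)) = 3 := by
  rw [three_eq_coe]
  apply le_antisymm
  · exact iSup_le fun n => EReal.coe_le_coe_iff.2 (height_biDbl_le (admissible_glue h) n)
  · refine le_of_forall_lt fun y hy => ?_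
    obtain ⟨c, hyc, hc⟩ := EReal.lt_iff_exists_real_btwn.1 hy
    have hc : c < 3 := EReal.coe_lt_coe_iff.1 hc
    obtain ⟨M, -, hM⟩ := exists_one_div_four_pow_lt (sub_pos.2 hc) 0
    obtain ⟨x, P, -, hP, hm⟩ := exists_long_mirror g e M
    have h' := abs_height_sub_three_le (l := l) ((hL _).1 hm)
    refine hyc.trans_le (le_iSup_of_le (2 * ((x.length + P.length : ℕ) : ℤ) + 1)
      (EReal.coe_le_coe_iff.2 ?_))
    linarith [hM _ hP, (abs_le.1 h').1]

theorem proj_biDbl_glue (s l : ℕ → Bool) : proj (biDbl (glue s l)) = dbl s := by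
  funext i
  rfl

/-! ### Uncountably many numbers -/

theorem exists_mem_Y3 {g : ℕ → Bool} (e : ℕ → Bool) :
    ∃ s : ℕ → Bool, (∀ w, w ∈ ray g e ↔ w = pre s w.length) ∧
      val s ∈ Y3 (mirrors (ray g e)).encard := by
  obtain ⟨s, l, hL, h⟩ := exists_admissible_extension g e
  have hs : ∀ n, Admissible (pre s n) := fun n => h 0 n
  refine ⟨s, hL, ⟨irrational_cfValue _, ?_, ?_⟩, biDbl (glue s l), markovValue_eq_three hL h, ?_⟩
  · exact lagrangeValue_eq_three (fun c hc => finite_lt_quality hs hc)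
      fun c hc => infinite_lt_quality hL hc
  · rw [val, encard_solutions_cfValue _ (by norm_num), encard_three_lt_quality hL hs]
  · rw [proj_biDbl_glue, val]

theorem not_countable_Y3 {g : ℕ → Bool} (hg : ∀ k, g k = false → g (k + 1) = false) {n : ℕ∞}
    (hn : ∀ e, (mirrors (ray g e)).encard = n) : ¬ (Y3 n).Countable := by
  choose s hs hY using fun e => exists_mem_Y3 (g := g) e
  have hinj : Function.Injective fun e => val (s e) := by
    intro e e' h
    apply ray_injective hg
    ext w
    rw [hs, hs, val_injective h]
  intro hc
  have : (Set.range fun e => val (s e)).Countable := by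
    refine hc.mono ?_
    rintro _ ⟨e, rfl⟩
    rw [← hn e]
    exact hY e
  have hcount : Countable (ℕ → Bool) := by
    have := this.to_subtype
    exact (Set.rangeFactorization_injective.2 hinj).countable
  obtain ⟨f, hf⟩ := exists_surjective_nat (ℕ → Bool)
  obtain ⟨k, hk⟩ := hf fun k => !f k k
  simpa using congrFun hk k

end LagrangeThree

theorem theorem2 (n : ℕ∞) : ¬ (LagrangeThree.Y3 n).Countable := by
  induction n using ENat.recTopCoe with
  | top =>
    exact LagrangeThree.not_countable_Y3 (g := fun _ => true) (by simp)
      LagrangeThree.encard_mirrors_ray_top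
  | coe n =>
    -- The first n blocks each add one mirrored prefix; the later ones, built on G', leave none of
    -- their own.
    refine LagrangeThree.not_countable_Y3 (g := fun k => decide (k < n)) ?_
      (LagrangeThree.encard_mirrors_ray_nat n)
    intro k hk
    simp at hk ⊢
    omega
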